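/- **Setting.** Let $d\ge 1$, $D=(0,1)^d$, and let $Z$ be a zero-mean stationary Gaussian random field on $\bar D=[0,1]^d$ with almost surely continuous sample paths and $\mathbb E[Z(\mathbf x)Z(\mathbf y)]=C(\mathbf x-\mathbf y)$, where $C:\mathbb R^d\to\mathbb R$ is continuous on $[-1,1]^d$ and satisfies $C(x_1,\dots,x_d)=C(|x_1|,\dots,|x_d|)$ there. Let $f\in H^{-1}(D)=(H^1_0(D))'$. *Circulant embedding.* For $m_i\ge 1$, $J_i\ge 0$ ($i=1,\dots,d$) consider the uniform grid $\mathcal T=\{(a_i/m_i)_i: 0\le a_i\le m_i\}$. Let $\varphi\in C_0^\infty(\mathbb R)$ with $\varphi=1$ on $[-1,1]$, $\operatorname{supp}\varphi=[-\kappa,\kappa]$, and let $C^{\rm ext}(\mathbf x)=\sum_{\mathbf n\in\mathbb Z^d}(C\varphi_\kappa)\big((x_i+2\ell_i n_i)_i\big)$ with $\varphi_\kappa(\mathbf y)=\varphi(\|\mathbf y\|_\infty)$ and $\ell_i=1+J_i/m_i$. For $0\le a_i\le m_i+J_i$ let $C_{\mathbf a}=C((a_i/m_i)_i)$ if $a_i\le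 m_i$ for all $i$, and $C_{\mathbf a}=C^{\rm ext}((a_i/m_i)_i)$ otherwise. The embedding matrix $S\in\mathbb R^{s\times s}$, $s=\prod_{i=1}^d 2(m_i+J_i)$, with rows and columns indexed by $\prod_i\{0,\dots,2(m_i+J_i)-1\}$, is the block circulant matrix with entries $S_{\mathbf p\mathbf q}=C_{\mathbf a}$, $a_i=\min(|p_i-q_i|,\,2(m_i+J_i)-|p_i-q_i|)$. Assume that $S$ is positive definite. Let $F$ be the unitary $d$-dimensional discrete Fourier matrix, $G=\Re F+\Im F$, $\Lambda$ the diagonal matrix of the eigenvalues $\sqrt s\,F\mathbf s$ of $S$ ($\mathbf s$ the first row of $S$), and write $\lambda_1\ge\dots\ge\lambda_s$ for these eigenvalues in non-increasing order. For $0\le k\le s$ let $\tilde\Lambda$ be $\Lambda$ with $\lambda_{s-k+1},\dots,\lambda_s$ replaced by $0$. Let $\boldsymbol\xi\sim\mathcal N(0,I_s)$ and let $\mathbf Z=(G\Lambda^{1/2}\boldsymbol\xi)_R$, $\tilde{\mathbf Z}=(G\tilde\Lambda^{1/2}\boldsymbol\xi)_R$, where $(\cdot)_R$ is the restriction to the indices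 with $0\le p_i\le m_i$, i.e. to the grid $\mathcal T$. *Finite elements.* Take any conforming simplicial triangulation of $\bar D$ with vertex set $\mathcal T$, let $\mathcal V_h\subset H^1_0(D)$ be the continuous piecewise linear functions, and let $Z_{\mathcal T},\tilde Z_{\mathcal T}$ be the piecewise linear interpolants of $\mathbf Z,\tilde{\mathbf Z}$. Fix on every element $\tau$ a quadrature rule with nodes $\mathbf y\in\tau$ and weights $w_{\tau,\mathbf y}\ge 0$ with $\sum_{\mathbf y} w_{\tau,\mathbf y}=1$ (for example the trapezoidal rule). Let $u_h(\cdot,\omega)\in\mathcal V_h$ be the finite element solution for the coefficient $\exp(Z_{\mathcal T})$: with $a(\mathbf x)=\exp(Z_{\mathcal T}(\mathbf x))$, $$\sum_\tau\Big(\sum_{\mathbf y}w_{\tau,\mathbf y}\,a(\mathbf y)\Big)\int_\tau\nabla u_h\cdot\nabla v\,d\mathbf x=\langle f,v\rangle\qquad\text{for all }v\in\mathcal V_h,$$ and let $\tilde u_h$ be the solution for the coefficient $\exp(\tilde Z_{\mathcal T})$. *Functional.* Let $\mathcal G:H^1(D)\to\mathbb R$ be continuously Fréchet differentiable, and let $C_F\in\bigcap_{q\ge1}L^q(\Omega)$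 be such that, for almost all $\omega$ and all $v\in H_0^1(D)$, $$\Big|\int_0^1 D_v\mathcal G\big(u_h+\theta(\tilde u_h-u_h)\big)\,d\theta\Big|\le C_F(\omega)\,\|v\|_{H^1(D)}.$$ Put $Q_h=\mathcal G(u_h)$ and $\tilde Q_h=\mathcal G(\tilde u_h)$. **Claim.** For every $p\in[1,\infty)$, $|Q_h-\tilde Q_h|^p$ is integrable and $$\mathbb E\big[|Q_h-\tilde Q_h|^p\big]\le c\; s^{-p/2}\Big(\max_{j=s-k+1,\dots,s}\sqrt{\lambda_j}\Big)^p k^p$$ (the right-hand side being $0$ for $k=0$), where the constant $c$ depends only on $d$, $p$, $C$, $f$ and on bounds for the moments $\|C_F\|_{L^q(\Omega)}$, $q\ge 1$; it does not depend on $m_i$, $J_i$, $\varphi$, $k$, $s$, the eigenvalues, the triangulation or the quadrature rule. -/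

import Mathlib

open MeasureTheory ProbabilityTheory Set
open scoped InnerProductSpace NNReal ENNReal

noncomputable section

namespace CES

/-! ### Domain, grid and covariance -/

/-- Euclidean space `ℝ^d`. -/
abbrev Space (d : ℕ) : Type := EuclideanSpace ℝ (Fin d)

/-- The physical domain `D = (0,1)^d`. -/
def openCube (d : ℕ) : Set (Space d) := {x | ∀ i, 0 < x i ∧ x i < 1}

/-- Its closure `[0,1]^d`. -/
def closedCube (d : ℕ) : Set (Space d) := {x | ∀ i, 0 ≤ x i ∧ x i ≤ 1}

/-- The cube `[-1,1]^d` of all differences of points of `[0,1]^d`. -/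
def diffCube (d : ℕ) : Set (Space d) := {x | ∀ i, |x i| ≤ 1}

/-- `Z` is a zero-mean stationary Gaussian random field on `[0,1]^d` with covariance
`E[Z(x) Z(y)] = C(x - y)` and almost surely continuous sample paths. -/
structure IsStationaryGaussianField {d : ℕ} {Ω : Type*} [MeasurableSpace Ω] (C : Space d → ℝ)
    (Z : closedCube d → Ω → ℝ) (P : Measure Ω) : Prop where
  gaussian : IsGaussianProcess Z P
  mean_zero : ∀ x, ∫ ω, Z x ω ∂P = 0
  cov : ∀ x y : closedCube d, ∫ ω, Z x ω * Z y ω ∂P = C ((x : Space d) - (y : Space d))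
  continuous_paths : ∀ᵐ ω ∂P, Continuous fun x => Z x ω

/-- Indices of the `∏ (m_i + 1)` grid points. -/
abbrev GridIdx {d : ℕ} (m : Fin d → ℕ) : Type := ∀ i, Fin (m i + 1)

/-- The point `(a_i / m_i)_i` of the uniform grid. -/
def gridPoint {d : ℕ} (m : Fin d → ℕ) (a : Fin d → ℕ) : Space d :=
  WithLp.toLp 2 fun i => (a i : ℝ) / (m i : ℝ)

/-- The set of grid points, `{(a_i / m_i)_i : 0 ≤ a_i ≤ m_i}`. -/
def gridPoints {d : ℕ} (m : Fin d → ℕ) : Set (Space d) :=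
  range fun a : GridIdx m => gridPoint m fun i => (a i : ℕ)

/-! ### Circulant embedding with smooth periodisation -/

/-- `φ ∈ C_0^∞(ℝ)` with `φ = 1` on `[-1,1]` and `supp φ = [-κ, κ]`. -/
structure IsSmoothCutoff (φ : ℝ → ℝ) (κ : ℝ) : Prop where
  smooth : ContDiff ℝ ((⊤ : ℕ∞) : WithTop ℕ∞) φ
  eq_one : ∀ t ∈ Icc (-1 : ℝ) 1, φ t = 1
  support : tsupport φ = Icc (-κ) κ

/-- The periodised covariance `C^ext(x) = ∑_{n ∈ ℤ^d} (C φ_κ)(x + 2 ℓ n)`, where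
`φ_κ(y) = φ(‖y‖_∞)`; `ℓ i` is the half-period in the `i`-th direction. -/
def periodisedCov {d : ℕ} (C : Space d → ℝ) (φ : ℝ → ℝ) (ℓ : Fin d → ℝ) (x : Space d) : ℝ :=
  ∑' n : Fin d → ℤ,
    C (WithLp.toLp 2 fun i => x i + 2 * ℓ i * (n i : ℝ)) *
      φ ‖(fun i => x i + 2 * ℓ i * (n i : ℝ) : Fin d → ℝ)‖

/-- The values `C_a`, `0 ≤ a_i ≤ m_i + J_i`, of the padded covariance: the covariance `C` itself
on the original grid, and the values of `C^ext`, with `ℓ_i = 1 + J_i / m_i`, at the padding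
points. -/
def paddedCov {d : ℕ} (C : Space d → ℝ) (φ : ℝ → ℝ) (m J : Fin d → ℕ) (a : Fin d → ℕ) : ℝ :=
  open Classical in
  if ∀ i, a i ≤ m i then C (gridPoint m a)
  else periodisedCov C φ (fun i => 1 + (J i : ℝ) / (m i : ℝ)) (gridPoint m a)

/-- Indices of the rows and columns of the embedding matrix. -/
abbrev EmbIdx {d : ℕ} (m J : Fin d → ℕ) : Type := ∀ i, Fin (2 * (m i + J i))

/-- The size `s = ∏ 2 (m_i + J_i)` of the embedding matrix. -/
def embSize {d : ℕ} (m J : Fin d → ℕ) : ℕ := ∏ i, 2 * (m i + J i)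

/-- Mirroring: the entry with index `a ∈ {0, …, 2n - 1}` of the list
`0, 1, …, n, n - 1, …, 1`. -/
def mirror (n a : ℕ) : ℕ := min a (2 * n - a)

/-- The embedding matrix `S`: the nested block circulant matrix with circulant blocks
`Toeplitz(S_0, …, S_n, S_{n-1}, …, S_1)` obtained by mirroring the padded covariance in every
direction. -/
def embMatrix {d : ℕ} (C : Space d → ℝ) (φ : ℝ → ℝ) (m J : Fin d → ℕ) :
    Matrix (EmbIdx m J) (EmbIdx m J) ℝ :=
  fun p q => paddedCov C φ m J fun i =>
    mirror (m i + J i) (((p i : ℕ) : ℤ) - ((q i : ℕ) : ℤ)).natAbs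

/-- The first row of the embedding matrix. -/
def embFirstRow {d : ℕ} (C : Space d → ℝ) (φ : ℝ → ℝ) (m J : Fin d → ℕ) : EmbIdx m J → ℝ :=
  fun q => paddedCov C φ m J fun i => mirror (m i + J i) (q i : ℕ)

/-- The unitary `d`-dimensional discrete Fourier matrix `F`. -/
def fourierMatrix {d : ℕ} (m J : Fin d → ℕ) : Matrix (EmbIdx m J) (EmbIdx m J) ℂ :=
  fun p q => ((1 / √(embSize m J : ℝ) : ℝ) : ℂ) *
    ∏ i, Complex.exp (2 * Real.pi * Complex.I * ((p i : ℕ) : ℂ) * ((q i : ℕ) : ℂ) /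
      ((2 * (m i + J i) : ℕ) : ℂ))

/-- The Hartley matrix `G = Re F + Im F`. -/
def hartleyMatrix {d : ℕ} (m J : Fin d → ℕ) : Matrix (EmbIdx m J) (EmbIdx m J) ℝ :=
  fun p q => (fourierMatrix m J p q).re + (fourierMatrix m J p q).im

/-- The eigenvalues `λ = √s F 𝐬` of the embedding matrix, `𝐬` being its first row. (The right-hand
side is real because `𝐬` is symmetric.) -/
def embEigenvalue {d : ℕ} (C : Space d → ℝ) (φ : ℝ → ℝ) (m J : Fin d → ℕ) : EmbIdx m J → ℝ :=
  fun p => (((√(embSize m J : ℝ) : ℝ) : ℂ) *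
    (fourierMatrix m J).mulVec (fun q => (embFirstRow C φ m J q : ℂ)) p).re

/-- The position of a grid index among the indices of the embedding matrix. -/
def gridEmb {d : ℕ} {m : Fin d → ℕ} (J : Fin d → ℕ) (hm : ∀ i, 0 < m i) (a : GridIdx m) :
    EmbIdx m J :=
  fun i => Fin.castLE (by have := hm i; omega) (a i)

/-- The vector `(G Λ^{1/2} ξ)_R`, where `Λ = diag lam` and `(·)_R` is the restriction to the grid. -/
def embSample {d : ℕ} {m : Fin d → ℕ} (J : Fin d → ℕ) (hm : ∀ i, 0 < m i)
    (lam : EmbIdx m J → ℝ) (ξ : EmbIdx m J → ℝ) : GridIdx m → ℝ :=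
  fun a => (hartleyMatrix m J * Matrix.diagonal fun q => √(lam q)).mulVec ξ (gridEmb J hm a)

/-- The vector `lam` with its entries number `s-k+1, …, s` in the ordering `e` set to zero
(`e j` is the position of the entry number `j + 1`). -/
def dropLast {d : ℕ} {m J : Fin d → ℕ} (e : Fin (embSize m J) ≃ EmbIdx m J) (k : ℕ)
    (lam : EmbIdx m J → ℝ) : EmbIdx m J → ℝ :=
  fun q => if (e.symm q : ℕ) + k < embSize m J then lam q else 0

/-! ### The Sobolev spaces `H^1(D)` and `H^1_0(D)` -/

/-- Lebesgue measure on `D`. -/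
abbrev volD (d : ℕ) : Measure (Space d) := volume.restrict (openCube d)

/-- Pairs `(u, g)` in `L²(D) × L²(D; ℝ^d)` with the norm `(‖u‖² + ‖g‖²)^{1/2}`. -/
abbrev L2Pair (d : ℕ) : Type := WithLp 2 (Lp ℝ 2 (volD d) × Lp (Space d) 2 (volD d))

/-- `φ ∈ C_c^∞(D)`. -/
structure IsTest {d : ℕ} (φ : Space d → ℝ) : Prop where
  smooth : ContDiff ℝ ((⊤ : ℕ∞) : WithTop ℕ∞) φ
  compact : HasCompactSupport φ
  support : tsupport φ ⊆ openCube d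

lemma volD_finite (d : ℕ) : volume (openCube d) < ⊤ := by
  have hb : Bornology.IsBounded (openCube d) := by
    refine (Metric.isBounded_closedBall (x := (0 : Space d)) (r := √d)).subset ?_
    intro x hx
    rw [mem_closedBall_zero_iff, EuclideanSpace.norm_eq]
    refine Real.sqrt_le_sqrt ?_
    calc ∑ i, ‖x i‖ ^ 2 ≤ ∑ _i : Fin d, (1 : ℝ) := by
          refine Finset.sum_le_sum fun i _ => ?_
          have h := hx i
          rw [Real.norm_eq_abs, sq_abs]
          nlinarith [h.1, h.2]
      _ = d := by simp
  exact hb.measure_lt_top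

instance (d : ℕ) : IsFiniteMeasure (volD d) := ⟨by
  simpa using volD_finite d⟩

lemma integrable_mul_of_test {d : ℕ} (u : Space d → ℝ) (hu : MemLp u 2 (volD d))
    (ψ : Space d → ℝ) (hψ : Continuous ψ) (hc : HasCompactSupport ψ) :
    Integrable (fun x => u x * ψ x) (volD d) := by
  obtain ⟨M, hM⟩ := hc.exists_bound_of_continuous hψ
  exact (hu.integrable (by norm_num)).mul_bdd (c := M) hψ.aestronglyMeasurable
    (Filter.Eventually.of_forall hM)

lemma memLp_apply {d : ℕ} (g : Lp (Space d) 2 (volD d)) (i : Fin d) :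
    MemLp (fun x => (g x : Space d) i) 2 (volD d) :=
  (EuclideanSpace.proj i : Space d →L[ℝ] ℝ).comp_memLp' (Lp.memLp g)

lemma test_deriv {d : ℕ} {φ : Space d → ℝ} (hφ : IsTest φ) (y : Space d) :
    Continuous (fun x => fderiv ℝ φ x y) ∧ HasCompactSupport (fun x => fderiv ℝ φ x y) :=
  ⟨(hφ.smooth.continuous_fderiv (by simp)).clm_apply continuous_const,
    hφ.compact.fderiv_apply (𝕜 := ℝ) y⟩

/-- The Sobolev space `H^1(D)`: all pairs `(u, ∇u)`, where `u ∈ L²(D)` has the weak gradient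
`∇u ∈ L²(D; ℝ^d)`. Its norm is `(‖u‖² + ‖∇u‖²)^{1/2}`. -/
def H1 (d : ℕ) : Submodule ℝ (L2Pair d) where
  carrier := {w | ∀ φ : Space d → ℝ, IsTest φ → ∀ i : Fin d,
    ∫ x, (w.fst x : ℝ) * fderiv ℝ φ x (EuclideanSpace.single i 1) ∂(volD d) =
      -∫ x, (w.snd x : Space d) i * φ x ∂(volD d)}
  zero_mem' := by
    intro φ _ i
    have h1 : ∀ᵐ x ∂(volD d), ((0 : L2Pair d).fst x : ℝ) = 0 := Lp.coeFn_zero _ _ _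
    have h2 : ∀ᵐ x ∂(volD d), ((0 : L2Pair d).snd x : Space d) = 0 := Lp.coeFn_zero _ _ _
    rw [integral_congr_ae (g := fun _ => (0 : ℝ)) (by filter_upwards [h1] with x hx; rw [hx]; simp),
      integral_congr_ae (f := fun x => ((0 : L2Pair d).snd x : Space d) i * φ x)
        (g := fun _ => (0 : ℝ)) (by filter_upwards [h2] with x hx; rw [hx]; simp)]
    simp
  add_mem' := by
    intro v w hv hw φ hφ i
    have h1 : ∀ᵐ x ∂(volD d), ((v + w).fst x : ℝ) = v.fst x + w.fst x :=
      Lp.coeFn_add v.fst w.fst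
    have h2 : ∀ᵐ x ∂(volD d), ((v + w).snd x : Space d) = v.snd x + w.snd x :=
      Lp.coeFn_add v.snd w.snd
    obtain ⟨hc, hs⟩ := test_deriv hφ (EuclideanSpace.single i 1)
    have hφc := hφ.smooth.continuous
    rw [integral_congr_ae
        (g := fun x => (v.fst x : ℝ) * fderiv ℝ φ x (EuclideanSpace.single i 1) +
          (w.fst x : ℝ) * fderiv ℝ φ x (EuclideanSpace.single i 1))
        (by filter_upwards [h1] with x hx; rw [hx]; ring),
      integral_congr_ae (f := fun x => ((v + w).snd x : Space d) i * φ x)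
        (g := fun x => (v.snd x : Space d) i * φ x + (w.snd x : Space d) i * φ x)
        (by filter_upwards [h2] with x hx; rw [hx, PiLp.add_apply]; ring),
      integral_add (integrable_mul_of_test _ (Lp.memLp _) _ hc hs)
        (integrable_mul_of_test _ (Lp.memLp _) _ hc hs),
      integral_add (integrable_mul_of_test _ (memLp_apply _ i) _ hφc hφ.compact)
        (integrable_mul_of_test _ (memLp_apply _ i) _ hφc hφ.compact),
      hv φ hφ i, hw φ hφ i]
    ring
  smul_mem' := by
    intro c w hw φ hφ i
    have h1 : ∀ᵐ x ∂(volD d), ((c • w).fst x : ℝ) = c * w.fst x := Lp.coeFn_smul c w.fst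
    have h2 : ∀ᵐ x ∂(volD d), ((c • w).snd x : Space d) = c • w.snd x := Lp.coeFn_smul c w.snd
    rw [integral_congr_ae
        (g := fun x => c * ((w.fst x : ℝ) * fderiv ℝ φ x (EuclideanSpace.single i 1)))
        (by filter_upwards [h1] with x hx; rw [hx]; ring),
      integral_congr_ae (f := fun x => ((c • w).snd x : Space d) i * φ x)
        (g := fun x => c * ((w.snd x : Space d) i * φ x))
        (by filter_upwards [h2] with x hx; rw [hx, PiLp.smul_apply, smul_eq_mul]; ring),
      integral_const_mul, integral_const_mul, hw φ hφ i]
    ring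

/-- The function part `u` of an element `(u, ∇u)` of `H^1(D)`. -/
def H1val {d : ℕ} (u : H1 d) : Lp ℝ 2 (volD d) := (u : L2Pair d).fst

/-- The weak gradient of an element of `H^1(D)`. -/
def H1grad {d : ℕ} (u : H1 d) : Lp (Space d) 2 (volD d) := (u : L2Pair d).snd

/-- `H^1_0(D)`: the closure of `C_c^∞(D)` in `H^1(D)`. -/
def H10 (d : ℕ) : Submodule ℝ (H1 d) :=
  (Submodule.span ℝ {u : H1 d | ∃ φ : Space d → ℝ, IsTest φ ∧ H1val u =ᵐ[volD d] φ}
    ).topologicalClosure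

/-! ### Piecewise linear finite elements with quadrature -/

/-- A (conforming, simplicial) triangulation of `[0,1]^d` whose vertices are the grid points. -/
structure IsGridTriangulation {d : ℕ} (m : Fin d → ℕ)
    (K : Geometry.SimplicialComplex ℝ (Space d)) : Prop where
  space_eq : K.space = closedCube d
  vertices_eq : K.vertices = gridPoints m

/-- The barycentric coordinates of `x` in the triangulation `K`, as a function of the vertex. -/
def baryCoord {d : ℕ} (K : Geometry.SimplicialComplex ℝ (Space d)) (x : Space d) :
    Space d → ℝ :=
  open Classical in
  if h : ∃ β : Space d → ℝ, ∃ τ ∈ K.faces, (∀ v ∈ τ, 0 ≤ β v) ∧ (∀ v ∉ τ, β v = 0) ∧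
      ∑ v ∈ τ, β v = 1 ∧ ∑ v ∈ τ, β v • v = x
  then h.choose else 0

/-- The piecewise linear interpolant on the triangulation `K` of a vector `z` of grid values. -/
def plInterpolant {d : ℕ} (m : Fin d → ℕ) (K : Geometry.SimplicialComplex ℝ (Space d))
    (z : GridIdx m → ℝ) (x : Space d) : ℝ :=
  ∑ a : GridIdx m, baryCoord K x (gridPoint m fun i => (a i : ℕ)) * z a

/-- A quadrature rule `⨍_τ k ≈ ∑_y w_{τ,y} k(y)` on every element `τ`, with nodes in the closed
element, nonnegative weights, and exact for constants. (Trapezoidal rule: the nodes are the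
vertices, with equal weights.) -/
structure QuadratureRule {d : ℕ} (K : Geometry.SimplicialComplex ℝ (Space d)) where
  nodes : Finset (Space d) → Finset (Space d)
  weight : Finset (Space d) → Space d → ℝ
  nodes_subset : ∀ τ ∈ K.facets, (nodes τ : Set (Space d)) ⊆ convexHull ℝ (τ : Set (Space d))
  weight_nonneg : ∀ τ ∈ K.facets, ∀ y ∈ nodes τ, 0 ≤ weight τ y
  weight_sum : ∀ τ ∈ K.facets, ∑ y ∈ nodes τ, weight τ y = 1

/-- The finite element space `V_h ⊂ H^1_0(D)` of continuous piecewise linear functions. -/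
def feSpace {d : ℕ} (K : Geometry.SimplicialComplex ℝ (Space d)) : Set (H10 d) :=
  {v | ∃ w : Space d → ℝ, ContinuousOn w (closedCube d) ∧
    (∀ τ ∈ K.faces, ∃ A : Space d →ᵃ[ℝ] ℝ, EqOn w A (convexHull ℝ (τ : Set (Space d)))) ∧
    H1val (v : H1 d) =ᵐ[volD d] w}

/-- The bilinear form `∑_τ (∑_y w_{τ,y} k(y)) ∫_τ ∇u · ∇v`, i.e. `∫_D k ∇u · ∇v` with the
coefficient integrated by quadrature on every element. -/
def feForm {d : ℕ} {K : Geometry.SimplicialComplex ℝ (Space d)} (R : QuadratureRule K)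
    (k : Space d → ℝ) (u v : H1 d) : ℝ :=
  ∑ᶠ τ ∈ K.facets, (∑ y ∈ R.nodes τ, R.weight τ y * k y) *
    ∫ x in convexHull ℝ (τ : Set (Space d)), ⟪H1grad u x, H1grad v x⟫_ℝ ∂(volD d)

/-- `u ∈ V_h` solves the discrete variational problem with coefficient `k` and source
`f ∈ H^{-1}(D)`, the dual of `H^1_0(D)`. -/
def IsFESolution {d : ℕ} {K : Geometry.SimplicialComplex ℝ (Space d)} (R : QuadratureRule K)
    (f : H10 d →L[ℝ] ℝ) (k : Space d → ℝ) (u : H10 d) : Prop :=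
  u ∈ feSpace K ∧ ∀ v ∈ feSpace K, feForm R k u v = f v

/-- The finite element solution `u_h`. -/
def feSolution {d : ℕ} {K : Geometry.SimplicialComplex ℝ (Space d)} (R : QuadratureRule K)
    (f : H10 d →L[ℝ] ℝ) (k : Space d → ℝ) : H10 d :=
  open Classical in if h : ∃ u, IsFESolution R f k u then h.choose else 0

/-- The finite element solution, as an element of `H^1(D)`, for the log-normal coefficient
`k = exp(Z_𝒯)`, where `Z_𝒯` is the piecewise linear interpolant of the grid values `z`. -/
def feSolutionOfSample {d : ℕ} (m : Fin d → ℕ) {K : Geometry.SimplicialComplex ℝ (Space d)}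
    (R : QuadratureRule K) (f : H10 d →L[ℝ] ℝ) (z : GridIdx m → ℝ) : H1 d :=
  (feSolution R f fun x => Real.exp (plInterpolant m K z x) : H10 d)

/-- The averaged Gateaux derivative `∫_0^1 D_v 𝒢(u + θ (w - u)) dθ`. -/
def avgDeriv {d : ℕ} (G : H1 d → ℝ) (u w v : H1 d) : ℝ :=
  ∫ θ in (0 : ℝ)..1, lineDeriv ℝ G (u + θ • (w - u)) v

end CES

end

/-!
The estimate rests on three facts, each with constants that do not see the grid, the padding or the
mesh.

*Pathwise stability of the finite elements.* The quadrature averages of `exp(Z_𝒯)` on the elements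
lie above `exp(-‖z‖)`, where `‖z‖` is the maximum of the grid values, because barycentric
coordinates are nonnegative and sum to one; for two samples they differ by at most
`exp(‖z‖ + ‖z'‖) ‖z - z'‖`. The energy argument for Galerkin solutions (`norm_galerkin_sub_le`),
with the Poincaré inequality on the unit cube (`norm_H1val_le`) and the fact that the elements cover
the domain, gives `‖u_h - ũ_h‖ ≤ 5 ‖f‖ exp(2‖z‖) exp(2‖z'‖) ‖z - z'‖`
(`norm_feSolutionOfSample_sub_le`). Discrete solutions exist because the finite element space is
finite dimensional, a piecewise linear function being determined by its values at the vertices.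

*The discarded part of the sample.* The entries of the Hartley matrix are at most `2 s^{-1/2}`, so
`‖z - z'‖` is at most `2 s^{-1/2}` times the largest discarded `√λ_j` times the sum of `|ξ_q|` over
the `k` discarded indices (`norm_embSample_sub_dropLast_le`).

*Uniform exponential moments.* The sample is a Gaussian vector, and by the Fourier analysis of the
circulant matrix its covariance is that of the field `Z` at the grid points
(`sum_hartleyMatrix_embEigenvalue`), so it has the law of `Z` restricted to the grid. Its maximum is
therefore dominated by the supremum of `Z` over `[0,1]^d`, which is almost surely finite; Fernique's
argument turns this into a bound for `E exp(r‖z‖)` depending only on the law of `Z`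
(`exists_exp_moment_bound`). The truncated sample is half the sum of two copies of the full one, the
second with the signs of the discarded variables reversed, so it inherits the bound by convexity
(`exists_embSample_moment_bound`).

The functional is treated by the mean value theorem along the segment from `u_h` to `ũ_h`, and the
resulting product of `C_F`, the exponentials and the average of the discarded `|ξ_q|` is separated
by the arithmetic-geometric mean inequality (`integral_prod_rpow_le`).
-/

namespace CES

/-! ### Hartley diagonalisation of convolution matrices on a finite abelian group -/

/-- A symmetric, unimodular and nondegenerate pairing of a finite abelian group with itself, i.e. an
identification of the group with its character group. -/
structure IsCharPairing {A : Type*} [AddCommGroup A] [Fintype A] [DecidableEq A]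
    (χ : A → A → ℂ) : Prop where
  symm : ∀ p q, χ p q = χ q p
  add : ∀ p p' q, χ (p + p') q = χ p q * χ p' q
  norm_one : ∀ p q, ‖χ p q‖ = 1
  sum_eq : ∀ p, ∑ q, χ p q = if p = 0 then (Fintype.card A : ℂ) else 0

namespace IsCharPairing

variable {A : Type*} [AddCommGroup A] [Fintype A] [DecidableEq A] {χ : A → A → ℂ}

lemma map_zero (h : IsCharPairing χ) (q : A) : χ 0 q = 1 := by
  have h0 : χ 0 q ≠ 0 := by
    intro h0
    simpa [h0] using h.norm_one 0 q
  have := h.add 0 0 q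
  rw [add_zero] at this
  exact (mul_eq_left₀ h0).mp this.symm

lemma map_neg (h : IsCharPairing χ) (p q : A) : χ (-p) q = (starRingEnd ℂ) (χ p q) := by
  have h1 : χ (-p) q * χ p q = 1 := by rw [← h.add, neg_add_cancel, h.map_zero]
  have h2 : (starRingEnd ℂ) (χ p q) * χ p q = 1 := by
    rw [mul_comm, Complex.mul_conj, Complex.normSq_eq_norm_sq, h.norm_one]; simp
  have h0 : χ p q ≠ 0 := by
    intro h0
    simpa [h0] using h.norm_one p q
  exact mul_right_cancel₀ h0 (h1.trans h2.symm)

/-- The Fourier transform of an even function is real. -/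
lemma coe_re_transform (h : IsCharPairing χ) {σ : A → ℝ} (hσ : ∀ x, σ (-x) = σ x) (r : A) :
    (((∑ q, χ r q * (σ q : ℂ)).re : ℝ) : ℂ) = ∑ q, χ r q * (σ q : ℂ) := by
  rw [← Complex.conj_eq_iff_re, map_sum, ← Equiv.sum_comp (Equiv.neg A)]
  refine Finset.sum_congr rfl fun q _ => ?_
  rw [map_mul, Complex.conj_ofReal, Equiv.neg_apply, hσ, h.symm r, h.map_neg, Complex.conj_conj,
    h.symm]

/-- Fourier inversion for an even function. -/
lemma sum_mul_transform (h : IsCharPairing χ) {σ : A → ℝ} (hσ : ∀ x, σ (-x) = σ x) (x : A) :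
    ∑ r, χ x r * (((∑ q, χ r q * (σ q : ℂ)).re : ℝ) : ℂ) = Fintype.card A * (σ x : ℂ) := by
  calc ∑ r, χ x r * (((∑ q, χ r q * (σ q : ℂ)).re : ℝ) : ℂ)
      = ∑ r, ∑ q, χ (x + q) r * (σ q : ℂ) := by
        refine Finset.sum_congr rfl fun r _ => ?_
        rw [h.coe_re_transform hσ, Finset.mul_sum]
        refine Finset.sum_congr rfl fun q _ => ?_
        rw [h.add, h.symm r q, mul_assoc]
    _ = ∑ q, (∑ r, χ (x + q) r) * (σ q : ℂ) := by
        rw [Finset.sum_comm]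
        exact Finset.sum_congr rfl fun q _ => (Finset.sum_mul _ _ _).symm
    _ = Fintype.card A * (σ x : ℂ) := by
        rw [Finset.sum_eq_single (-x)]
        · rw [h.sum_eq, if_pos (add_neg_cancel x), hσ]
        · intro q _ hq
          rw [h.sum_eq, if_neg (fun hx => hq (neg_eq_of_add_eq_zero_right hx).symm), zero_mul]
        · simp

/-- The identity `(Re a + Im a)(Re b + Im b) = Re (a * conj b) + Im (a * b)` for characters. -/
lemma hartley_mul (h : IsCharPairing χ) (p p' q : A) :
    ((χ p q).re + (χ p q).im) * ((χ p' q).re + (χ p' q).im) =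
      (χ (p - p') q).re + (χ (p + p') q).im := by
  rw [sub_eq_add_neg, h.add, h.add, h.map_neg]
  simp only [Complex.mul_re, Complex.mul_im, Complex.conj_re, Complex.conj_im]
  ring

/-- The Hartley matrix diagonalises the matrix `(σ (p - q))` of convolution with an even
function. -/
lemma sum_hartley_transform (h : IsCharPairing χ) {σ : A → ℝ} (hσ : ∀ x, σ (-x) = σ x)
    (p p' : A) :
    ∑ q, ((χ p q).re + (χ p q).im) * ((χ p' q).re + (χ p' q).im) *
      (∑ x, χ q x * (σ x : ℂ)).re = Fintype.card A * σ (p - p') := by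
  have h1 := congrArg Complex.re (h.sum_mul_transform hσ (p - p'))
  have h2 := congrArg Complex.im (h.sum_mul_transform hσ (p + p'))
  simp only [Complex.re_sum, Complex.im_sum, Complex.re_mul_ofReal, Complex.im_mul_ofReal,
    Complex.natCast_re, Complex.natCast_im] at h1 h2
  rw [zero_mul] at h2
  rw [← h1, ← add_zero (∑ r, (χ (p - p') r).re * _), ← h2, ← Finset.sum_add_distrib]
  refine Finset.sum_congr rfl fun q _ => ?_
  rw [h.hartley_mul, add_mul]
  simp only [Complex.re_sum, Complex.re_mul_ofReal]

/-- The Hartley matrix is orthogonal up to scaling. -/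
lemma sum_hartley (h : IsCharPairing χ) (p p' : A) :
    ∑ q, ((χ p q).re + (χ p q).im) * ((χ p' q).re + (χ p' q).im) =
      if p = p' then (Fintype.card A : ℝ) else 0 := by
  have h1 := congrArg Complex.re (h.sum_eq (p - p'))
  have h2 := congrArg Complex.im (h.sum_eq (p + p'))
  rw [Complex.re_sum] at h1
  rw [Complex.im_sum] at h2
  simp only [h.hartley_mul, Finset.sum_add_distrib, h1, h2, sub_eq_zero]
  split_ifs <;> simp

end IsCharPairing

/-! ### The characters of a product of cyclic groups -/

/-- The character `q ↦ exp (2π i ∑ p_i q_i / N_i)` of the product of the cyclic groups of orders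
`N_i`, as a pairing. -/
noncomputable def cyclicChar {d : ℕ} (N : Fin d → ℕ) (p q : ∀ i, Fin (N i)) : ℂ :=
  ∏ i, Complex.exp (2 * Real.pi * Complex.I * ((p i : ℕ) : ℂ) * ((q i : ℕ) : ℂ) / (N i : ℂ))

lemma exp_two_pi_mul_div (n a b : ℕ) :
    Complex.exp (2 * Real.pi * Complex.I * (a : ℂ) * (b : ℂ) / (n : ℂ)) =
      (Complex.exp (2 * Real.pi * Complex.I / n) ^ a) ^ b := by
  rw [← Complex.exp_nat_mul, ← Complex.exp_nat_mul]
  congr 1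
  ring

lemma exp_two_pi_mod {n : ℕ} (hn : n ≠ 0) (a : ℕ) :
    Complex.exp (2 * Real.pi * Complex.I / n) ^ (a % n) =
      Complex.exp (2 * Real.pi * Complex.I / n) ^ a := by
  conv_rhs => rw [← Nat.div_add_mod a n, pow_add, pow_mul,
    (Complex.isPrimitiveRoot_exp n hn).pow_eq_one, one_pow, one_mul]

lemma sum_exp_two_pi {n : ℕ} [NeZero n] (a : Fin n) :
    ∑ b : Fin n, Complex.exp (2 * Real.pi * Complex.I * ((a : ℕ) : ℂ) * ((b : ℕ) : ℂ) / (n : ℂ)) =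
      if a = 0 then (n : ℂ) else 0 := by
  have hp := Complex.isPrimitiveRoot_exp n (NeZero.ne n)
  simp only [exp_two_pi_mul_div]
  rw [Fin.sum_univ_eq_sum_range (fun b => (Complex.exp (2 * Real.pi * Complex.I / n) ^ (a : ℕ)) ^ b)]
  split_ifs with h
  · simp [h]
  · have h1 : Complex.exp (2 * Real.pi * Complex.I / n) ^ (a : ℕ) ≠ 1 := by
      intro h1
      have h2 := hp.dvd_of_pow_eq_one _ h1
      exact h (Fin.ext (by simpa using Nat.eq_zero_of_dvd_of_lt h2 a.isLt))
    rw [geom_sum_eq h1, pow_right_comm, hp.pow_eq_one, one_pow, sub_self, zero_div]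

lemma isCharPairing_cyclicChar {d : ℕ} (N : Fin d → ℕ) [∀ i, NeZero (N i)] :
    IsCharPairing (cyclicChar N) where
  symm p q := Finset.prod_congr rfl fun i _ => by ring_nf
  add p p' q := by
    rw [cyclicChar, cyclicChar, cyclicChar, ← Finset.prod_mul_distrib]
    refine Finset.prod_congr rfl fun i _ => ?_
    simp only [exp_two_pi_mul_div, Pi.add_apply, Fin.val_add]
    rw [exp_two_pi_mod (NeZero.ne _), pow_add, mul_pow]
  norm_one p q := by
    rw [cyclicChar, norm_prod]
    refine Finset.prod_eq_one fun i _ => ?_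
    rw [show (2 * Real.pi * Complex.I * ((p i : ℕ) : ℂ) * ((q i : ℕ) : ℂ) / (N i : ℂ) : ℂ) =
      ((2 * Real.pi * (p i : ℕ) * (q i : ℕ) / (N i) : ℝ) : ℂ) * Complex.I by push_cast; ring]
    exact Complex.norm_exp_ofReal_mul_I _
  sum_eq p := by
    simp only [cyclicChar]
    rw [← Fintype.prod_sum (fun i (b : Fin (N i)) =>
      Complex.exp (2 * Real.pi * Complex.I * ((p i : ℕ) : ℂ) * ((b : ℕ) : ℂ) / (N i : ℂ)))]
    simp only [sum_exp_two_pi]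
    split_ifs with h
    · simp [h, Fintype.card_pi]
    · obtain ⟨i, hi⟩ := Function.ne_iff.mp h
      exact Finset.prod_eq_zero (Finset.mem_univ i) (if_neg hi)

/-! ### The embedding matrix -/

section Embedding

variable {d : ℕ} (C : Space d → ℝ) (φ : ℝ → ℝ) {m : Fin d → ℕ} (J : Fin d → ℕ)

lemma mirror_natAbs_sub (n : ℕ) [NeZero (2 * n)] (p q : Fin (2 * n)) :
    mirror n (((p : ℕ) : ℤ) - ((q : ℕ) : ℤ)).natAbs = mirror n ((p - q : Fin (2 * n)) : ℕ) := by
  have hp := p.isLt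
  have hq := q.isLt
  unfold mirror
  rcases le_or_gt q p with h | h
  · rw [Fin.sub_val_of_le h]
    have : (q : ℕ) ≤ p := h
    congr 1 <;> omega
  · have h' : (p : ℕ) < q := h
    rw [Fin.coe_sub_iff_lt.mpr h]
    omega

lemma mirror_neg (n : ℕ) [NeZero (2 * n)] (p : Fin (2 * n)) :
    mirror n ((-p : Fin (2 * n)) : ℕ) = mirror n (p : ℕ) := by
  have hp := p.isLt
  rw [Fin.val_neg]
  split_ifs with h
  · simp [h]
  · unfold mirror
    omega

lemma card_embIdx : Fintype.card (EmbIdx m J) = embSize m J := by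
  simp [embSize, Fintype.card_pi]

lemma embSize_pos (hm : ∀ i, 0 < m i) : 0 < embSize m J :=
  Finset.prod_pos fun i _ => by have := hm i; omega

lemma fourierMatrix_apply (p q : EmbIdx m J) :
    fourierMatrix m J p q = ((1 / √(embSize m J : ℝ) : ℝ) : ℂ) *
      cyclicChar (fun i => 2 * (m i + J i)) p q := rfl

lemma hartleyMatrix_apply (p q : EmbIdx m J) :
    hartleyMatrix m J p q = (√(embSize m J : ℝ))⁻¹ *
      ((cyclicChar (fun i => 2 * (m i + J i)) p q).re +
        (cyclicChar (fun i => 2 * (m i + J i)) p q).im) := by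
  rw [hartleyMatrix, fourierMatrix_apply, Complex.re_ofReal_mul, Complex.im_ofReal_mul]
  ring

lemma hartleyMatrix_symm (hm : ∀ i, 0 < m i) (p q : EmbIdx m J) :
    hartleyMatrix m J p q = hartleyMatrix m J q p := by
  have : ∀ i, NeZero (2 * (m i + J i)) := fun i => ⟨by have := hm i; omega⟩
  rw [hartleyMatrix_apply, hartleyMatrix_apply, (isCharPairing_cyclicChar _).symm]

lemma abs_hartleyMatrix_le (hm : ∀ i, 0 < m i) (p q : EmbIdx m J) :
    |hartleyMatrix m J p q| ≤ 2 * (√(embSize m J : ℝ))⁻¹ := by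
  have : ∀ i, NeZero (2 * (m i + J i)) := fun i => ⟨by have := hm i; omega⟩
  have h1 := (isCharPairing_cyclicChar fun i => 2 * (m i + J i)).norm_one p q
  rw [hartleyMatrix_apply, abs_mul, abs_of_nonneg (by positivity), mul_comm]
  gcongr
  refine (abs_add_le _ _).trans ?_
  have h2 := Complex.abs_re_le_norm (cyclicChar (fun i => 2 * (m i + J i)) p q)
  have h3 := Complex.abs_im_le_norm (cyclicChar (fun i => 2 * (m i + J i)) p q)
  linarith

lemma embEigenvalue_eq (hm : ∀ i, 0 < m i) (p : EmbIdx m J) :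
    embEigenvalue C φ m J p =
      (∑ q, cyclicChar (fun i => 2 * (m i + J i)) p q * (embFirstRow C φ m J q : ℂ)).re := by
  have hs : (0 : ℝ) < √(embSize m J : ℝ) := Real.sqrt_pos.mpr (mod_cast embSize_pos J hm)
  unfold embEigenvalue Matrix.mulVec dotProduct
  simp only [fourierMatrix_apply, mul_assoc]
  rw [← Finset.mul_sum, ← mul_assoc, ← Complex.ofReal_mul, mul_one_div_cancel hs.ne',
    Complex.ofReal_one, one_mul]

/-- `S = G Λ G`, entrywise. -/
lemma sum_hartleyMatrix_embEigenvalue (hm : ∀ i, 0 < m i) (p p' : EmbIdx m J) :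
    ∑ q, hartleyMatrix m J p q * hartleyMatrix m J p' q * embEigenvalue C φ m J q =
      embMatrix C φ m J p p' := by
  have hN : ∀ i, NeZero (2 * (m i + J i)) := fun i => ⟨by have := hm i; omega⟩
  have hσ : ∀ x, embFirstRow C φ m J (-x) = embFirstRow C φ m J x := fun x => by
    unfold embFirstRow
    congr 1
    funext i
    exact mirror_neg _ _
  have hs : (0 : ℝ) < (embSize m J : ℝ) := mod_cast embSize_pos J hm
  have h := (isCharPairing_cyclicChar fun i => 2 * (m i + J i)).sum_hartley_transform hσ p p'
  have hcard : (Fintype.card (∀ i, Fin (2 * (m i + J i))) : ℝ) = embSize m J := by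
    rw [← card_embIdx (m := m) J]
  rw [hcard] at h
  have hS : embMatrix C φ m J p p' = embFirstRow C φ m J (p - p') := by
    unfold embMatrix embFirstRow
    congr 1
    funext i
    exact mirror_natAbs_sub _ _ _
  rw [hS, ← mul_right_inj' hs.ne', ← h, Finset.mul_sum]
  refine Finset.sum_congr rfl fun q _ => ?_
  rw [hartleyMatrix_apply, hartleyMatrix_apply, embEigenvalue_eq C φ J hm]
  have h2 : (embSize m J : ℝ) * ((√(embSize m J : ℝ))⁻¹ * (√(embSize m J : ℝ))⁻¹) = 1 := by
    rw [← mul_inv, Real.mul_self_sqrt hs.le, mul_inv_cancel₀ hs.ne']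
  linear_combination ((cyclicChar (fun i => 2 * (m i + J i)) p q).re +
        (cyclicChar (fun i => 2 * (m i + J i)) p q).im) *
    ((cyclicChar (fun i => 2 * (m i + J i)) p' q).re +
        (cyclicChar (fun i => 2 * (m i + J i)) p' q).im) *
    (∑ x, cyclicChar (fun i => 2 * (m i + J i)) q x * (embFirstRow C φ m J x : ℂ)).re * h2

/-- `G` is orthogonal, entrywise. -/
lemma sum_hartleyMatrix_mul (hm : ∀ i, 0 < m i) (p p' : EmbIdx m J) :
    ∑ q, hartleyMatrix m J p q * hartleyMatrix m J p' q = if p = p' then 1 else 0 := by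
  have hN : ∀ i, NeZero (2 * (m i + J i)) := fun i => ⟨by have := hm i; omega⟩
  have hs : (0 : ℝ) < (embSize m J : ℝ) := mod_cast embSize_pos J hm
  have h := (isCharPairing_cyclicChar fun i => 2 * (m i + J i)).sum_hartley p p'
  have hcard : (Fintype.card (∀ i, Fin (2 * (m i + J i))) : ℝ) = embSize m J := by
    rw [← card_embIdx (m := m) J]
  rw [hcard] at h
  have h2 : (√(embSize m J : ℝ))⁻¹ * (√(embSize m J : ℝ))⁻¹ = (embSize m J : ℝ)⁻¹ := by
    rw [← mul_inv, Real.mul_self_sqrt hs.le]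
  simp only [hartleyMatrix_apply, mul_mul_mul_comm, h2]
  rw [← Finset.mul_sum, h]
  split_ifs <;> simp [hs.ne']

/-- The numbers `λ` are values of the quadratic form of `S`, hence nonnegative. -/
lemma embEigenvalue_nonneg (hm : ∀ i, 0 < m i) (hS : (embMatrix C φ m J).PosSemidef)
    (r : EmbIdx m J) : 0 ≤ embEigenvalue C φ m J r := by
  have h := hS.dotProduct_mulVec_nonneg fun p => hartleyMatrix m J p r
  suffices hval : (∑ p, ∑ p', hartleyMatrix m J p r * (embMatrix C φ m J p p' *
      hartleyMatrix m J p' r)) = embEigenvalue C φ m J r by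
    rw [← hval]
    simpa [dotProduct, Matrix.mulVec, Finset.mul_sum] using h
  have hG : ∀ q, ∑ p, hartleyMatrix m J p r * hartleyMatrix m J p q = if r = q then 1 else 0 :=
    fun q => by
      rw [← sum_hartleyMatrix_mul J hm r q]
      exact Finset.sum_congr rfl fun p _ => by
        rw [hartleyMatrix_symm J hm p r, hartleyMatrix_symm J hm p q]
  calc ∑ p, ∑ p', hartleyMatrix m J p r * (embMatrix C φ m J p p' * hartleyMatrix m J p' r)
      = ∑ p, ∑ p', ∑ q, (hartleyMatrix m J p r * hartleyMatrix m J p q) *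
          (hartleyMatrix m J p' r * hartleyMatrix m J p' q) * embEigenvalue C φ m J q := by
        refine Finset.sum_congr rfl fun p _ => Finset.sum_congr rfl fun p' _ => ?_
        rw [← sum_hartleyMatrix_embEigenvalue C φ J hm, Finset.sum_mul, Finset.mul_sum]
        exact Finset.sum_congr rfl fun q _ => by ring
    _ = ∑ q, ∑ p, ∑ p', (hartleyMatrix m J p r * hartleyMatrix m J p q) *
          (hartleyMatrix m J p' r * hartleyMatrix m J p' q) * embEigenvalue C φ m J q := by
        rw [Finset.sum_comm]
        rw [Finset.sum_congr rfl fun p' _ => Finset.sum_comm]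
        rw [Finset.sum_comm]
        exact Finset.sum_congr rfl fun q _ => Finset.sum_comm
    _ = ∑ q, (if r = q then 1 else 0) * (if r = q then 1 else 0) * embEigenvalue C φ m J q := by
        refine Finset.sum_congr rfl fun q _ => ?_
        rw [← hG q, Finset.sum_mul_sum, Finset.sum_mul]
        exact Finset.sum_congr rfl fun p _ => (Finset.sum_mul _ _ _).symm
    _ = embEigenvalue C φ m J r := by simp

/-- On the original grid the embedding matrix reproduces the covariance matrix of the field. -/
lemma embMatrix_gridEmb (hm : ∀ i, 0 < m i)
    (hCsymm : ∀ x ∈ diffCube d, C (WithLp.toLp 2 fun i => |x i|) = C x) (a b : GridIdx m) :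
    embMatrix C φ m J (gridEmb J hm a) (gridEmb J hm b) =
      C (gridPoint m (fun i => (a i : ℕ)) - gridPoint m fun i => (b i : ℕ)) := by
  have hidx : (fun i => mirror (m i + J i)
      (((gridEmb J hm a i : ℕ) : ℤ) - ((gridEmb J hm b i : ℕ) : ℤ)).natAbs) =
      fun i => (((a i : ℕ) : ℤ) - ((b i : ℕ) : ℤ)).natAbs := by
    funext i
    have ha := (a i).isLt
    have hb := (b i).isLt
    simp only [gridEmb, Fin.val_castLE, mirror]
    omega
  have hcoord : ∀ i, |((a i : ℕ) : ℝ) / m i - ((b i : ℕ) : ℝ) / m i| =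
      ((((a i : ℕ) : ℤ) - ((b i : ℕ) : ℤ)).natAbs : ℝ) / m i := fun i => by
    rw [← sub_div, abs_div, abs_of_nonneg (Nat.cast_nonneg (m i) : (0 : ℝ) ≤ m i), Nat.cast_natAbs]
    push_cast
    rfl
  have hle : ∀ i, (((a i : ℕ) : ℤ) - ((b i : ℕ) : ℤ)).natAbs ≤ m i := fun i => by
    have ha := (a i).isLt
    have hb := (b i).isLt
    omega
  unfold embMatrix
  rw [hidx, paddedCov, if_pos hle,
    ← hCsymm (gridPoint m (fun i => (a i : ℕ)) - gridPoint m fun i => (b i : ℕ))]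
  · congr 1
    ext i
    exact (hcoord i).symm
  · intro i
    have h0 : (0 : ℝ) < m i := mod_cast hm i
    have : (gridPoint m (fun i => (a i : ℕ)) - gridPoint m fun i => (b i : ℕ)) i =
      ((a i : ℕ) : ℝ) / m i - ((b i : ℕ) : ℝ) / m i := rfl
    rw [this, hcoord i, div_le_one h0]
    exact_mod_cast hle i

lemma embSample_apply (hm : ∀ i, 0 < m i) (lam ξ : EmbIdx m J → ℝ) (a : GridIdx m) :
    embSample J hm lam ξ a = ∑ q, hartleyMatrix m J (gridEmb J hm a) q * √(lam q) * ξ q := by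
  simp [embSample, Matrix.mulVec, dotProduct, Matrix.mul_diagonal]

end Embedding

/-! ### Exponential moments of the Gaussian field, uniformly over all grids -/

/-- The variance of a linear functional of a centred Gaussian vector in terms of the covariance
matrix. -/
lemma integral_and_variance_dual {ι Ω : Type*} [Fintype ι] [DecidableEq ι] [MeasurableSpace Ω]
    {P : Measure Ω} {X : Ω → ι → ℝ} (hX : HasGaussianLaw X P) (hX0 : ∀ a, ∫ ω, X ω a ∂P = 0)
    (L : StrongDual ℝ (ι → ℝ)) :
    ∫ ω, L (X ω) ∂P = 0 ∧ Var[fun ω => L (X ω); P] =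
      ∑ a, ∑ b, L (Pi.single a 1) * L (Pi.single b 1) * ∫ ω, X ω a * X ω b ∂P := by
  have hL : ∀ ω, L (X ω) = ∑ a, L (Pi.single a 1) * X ω a := fun ω => by
    conv_lhs => rw [pi_eq_sum_univ' (X ω), map_sum]
    refine Finset.sum_congr rfl fun a _ => ?_
    rw [map_smul, smul_eq_mul, mul_comm]
  have hmem : ∀ a, MemLp (fun ω => X ω a) 2 P := fun a =>
    (HasGaussianLaw.eval (X := fun a ω => X ω a) hX a).memLp_two
  have := hX.isProbabilityMeasure
  have hint : ∫ ω, L (X ω) ∂P = 0 := by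
    simp only [hL]
    rw [integral_finsetSum _ fun a _ => ((hmem a).integrable (by norm_num)).const_mul _]
    simp [integral_const_mul, hX0]
  refine ⟨hint, ?_⟩
  have hLm : AEMeasurable (fun ω => L (X ω)) P :=
    L.continuous.measurable.comp_aemeasurable hX.aemeasurable
  rw [variance_of_integral_eq_zero hLm hint]
  have hprod : ∀ a b, Integrable (fun ω => X ω a * X ω b) P := fun a b =>
    (hmem a).integrable_mul (hmem b)
  have hsq : ∀ ω, L (X ω) ^ 2 =
      ∑ a, ∑ b, L (Pi.single a 1) * L (Pi.single b 1) * (X ω a * X ω b) := fun ω => by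
    rw [hL, sq, Finset.sum_mul_sum]
    exact Finset.sum_congr rfl fun a _ => Finset.sum_congr rfl fun b _ => by ring
  simp only [hsq]
  rw [integral_finsetSum _ fun a _ => integrable_finsetSum _ fun b _ => (hprod a b).const_mul _]
  refine Finset.sum_congr rfl fun a _ => ?_
  rw [integral_finsetSum _ fun b _ => (hprod a b).const_mul _]
  exact Finset.sum_congr rfl fun b _ => integral_const_mul _ _

/-- Centred Gaussian vectors with the same covariance matrix have the same law. -/
lemma map_eq_map_of_covariance {ι Ω Ω' : Type*} [Fintype ι] [MeasurableSpace Ω]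
    [MeasurableSpace Ω'] {P : Measure Ω} {P' : Measure Ω'} {X : Ω → ι → ℝ} {Y : Ω' → ι → ℝ}
    (hX : HasGaussianLaw X P) (hY : HasGaussianLaw Y P')
    (hX0 : ∀ a, ∫ ω, X ω a ∂P = 0) (hY0 : ∀ a, ∫ ω, Y ω a ∂P' = 0)
    (hcov : ∀ a b, ∫ ω, X ω a * X ω b ∂P = ∫ ω, Y ω a * Y ω b ∂P') :
    P.map X = P'.map Y := by
  classical
  have := hX.isGaussian_map
  have := hY.isGaussian_map
  refine Measure.ext_of_charFunDual ?_
  ext L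
  rw [hX.charFunDual_map_eq_fun, hY.charFunDual_map_eq_fun]
  obtain ⟨h1, h2⟩ := integral_and_variance_dual hX hX0 L
  obtain ⟨h3, h4⟩ := integral_and_variance_dual hY hY0 L
  rw [h1, h3, h2, h4]
  simp only [hcov]

/-- Fernique's theorem with constants that depend only on a radius `a` of a ball that carries
three quarters of the mass. -/
lemma lintegral_exp_norm_sq_le (a : ℝ) (ha : 0 < a) : ∃ κ : ℝ, 0 < κ ∧ ∃ M : ℝ≥0,
    ∀ {E : Type} [NormedAddCommGroup E] [NormedSpace ℝ E] [CompleteSpace E]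
      [SecondCountableTopology E] [MeasurableSpace E] [BorelSpace E] (μ : Measure E) [IsGaussian μ],
      ∫ x, x ∂μ = 0 → 3 / 4 ≤ μ {x | ‖x‖ ≤ a} →
      ∫⁻ x, .ofReal (Real.exp (κ * ‖x‖ ^ 2)) ∂μ ≤ M := by
  have h34 : (2 : ℝ≥0∞)⁻¹ < 3 / 4 := by
    rw [← ENNReal.toReal_lt_toReal (by simp) (by finiteness)]
    norm_num
  have h34' : (3 / 4 : ℝ≥0∞) < 1 := by
    rw [← ENNReal.toReal_lt_toReal (by finiteness) (by simp)]
    norm_num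
  have hfin : ENNReal.ofReal (Real.exp (Fernique.logRatio (3 / 4)))
        + ∑' n : ℕ, ENNReal.ofReal (Real.exp
          (-2⁻¹ * Real.log ((3 / 4 : ℝ≥0∞) / (1 - 3 / 4)).toReal * 2 ^ n)) ≠ ⊤ := by
    refine (ENNReal.add_lt_top.mpr ⟨ENNReal.ofReal_lt_top, ?_⟩).ne
    refine Summable.tsum_ofReal_lt_top <| Real.summable_exp_nat_mul_of_ge ?_
      (fun i => mod_cast (Nat.lt_pow_self (by simp)).le)
    refine mul_neg_of_neg_of_pos (by simp) (Real.log_pos ?_)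
    rw [ENNReal.toReal_div, ENNReal.toReal_sub_of_le h34'.le (by simp)]
    norm_num
  refine ⟨Fernique.logRatio (3 / 4) * a⁻¹ ^ 2,
    mul_pos (Fernique.logRatio_pos h34 h34') (by positivity), ENNReal.toNNReal
      (ENNReal.ofReal (Real.exp (Fernique.logRatio (3 / 4))) + ∑' n : ℕ, ENNReal.ofReal (Real.exp
        (-2⁻¹ * Real.log ((3 / 4 : ℝ≥0∞) / (1 - 3 / 4)).toReal * 2 ^ n))), ?_⟩
  · intro E _ _ _ _ _ _ μ _ hμ hball
    rw [ENNReal.coe_toNNReal hfin]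
    exact lintegral_exp_mul_sq_norm_le_of_map_rotation_eq_self
      (IsGaussian.map_rotation_eq_self hμ _) hball h34

lemma gridPoint_mem_closedCube {d : ℕ} {m : Fin d → ℕ} (hm : ∀ i, 0 < m i) (a : GridIdx m) :
    gridPoint m (fun i => (a i : ℕ)) ∈ closedCube d := by
  intro i
  have h0 : (0 : ℝ) < m i := mod_cast hm i
  have h1 : (((a i : ℕ) : ℕ) : ℝ) ≤ m i := mod_cast Nat.lt_succ_iff.mp (a i).isLt
  exact ⟨by simp only [gridPoint]; positivity, by simpa [gridPoint, div_le_one h0] using h1⟩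

lemma isCompact_closedCube (d : ℕ) : IsCompact (closedCube d) := by
  have h : closedCube d = WithLp.toLp 2 '' (Set.univ.pi fun _ : Fin d => Icc (0 : ℝ) 1) := by
    ext x
    constructor
    · intro hx
      exact ⟨WithLp.ofLp x, fun i _ => hx i, rfl⟩
    · rintro ⟨y, hy, rfl⟩ i
      exact hy i (mem_univ i)
  rw [h]
  exact (isCompact_univ_pi fun _ => isCompact_Icc).image (PiLp.continuous_toLp 2 _)

/-- A field with continuous paths on the compact cube is bounded by some constant with probability
at least three quarters. -/
lemma exists_measure_bounded {d : ℕ} {C : Space d → ℝ} {Ω₀ : Type*} [MeasurableSpace Ω₀]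
    {P₀ : Measure Ω₀} {Z : closedCube d → Ω₀ → ℝ} (hZ : IsStationaryGaussianField C Z P₀) :
    ∃ n : ℕ, 3 / 4 ≤ P₀ {ω | ∀ x, |Z x ω| ≤ n} := by
  have := hZ.gaussian.isProbabilityMeasure
  have hcover : P₀ (⋃ n : ℕ, {ω | ∀ x, |Z x ω| ≤ n}) = 1 := by
    refine (measure_congr (Filter.eventuallyEq_univ.mpr ?_)).trans measure_univ
    filter_upwards [hZ.continuous_paths] with ω hω
    have : CompactSpace (closedCube d) := isCompact_iff_compactSpace.mp (isCompact_closedCube d)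
    obtain ⟨M, hM⟩ := (isCompact_range hω.abs).bddAbove
    obtain ⟨n, hn⟩ := exists_nat_ge M
    exact mem_iUnion.mpr ⟨n, fun x => (hM ⟨x, rfl⟩).trans hn⟩
  have hmono : Monotone fun n : ℕ => {ω | ∀ x, |Z x ω| ≤ n} := fun n n' h ω hω x =>
    (hω x).trans (mod_cast h)
  have hlim := tendsto_measure_iUnion_atTop (μ := P₀) hmono
  rw [hcover] at hlim
  have h34 : (3 / 4 : ℝ≥0∞) < 1 := by
    rw [← ENNReal.toReal_lt_toReal (by finiteness) (by simp)]
    norm_num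
  obtain ⟨n, hn⟩ := (hlim.eventually (lt_mem_nhds h34)).exists
  exact ⟨n, hn.le⟩

lemma exp_mul_le_exp_sq {κ : ℝ} (hκ : 0 < κ) (r t : ℝ) :
    Real.exp (r * t) ≤ Real.exp (r ^ 2 / (4 * κ)) * Real.exp (κ * t ^ 2) := by
  rw [← Real.exp_add, Real.exp_le_exp, ← sub_nonneg]
  have : r ^ 2 / (4 * κ) + κ * t ^ 2 - r * t = (r - 2 * κ * t) ^ 2 / (4 * κ) := by
    field_simp
    ring
  rw [this]
  positivity

/-- All Gaussian vectors that have the law of the field on some grid satisfy a common bound for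
their exponential moments. -/
lemma exists_exp_moment_bound {d : ℕ} {C : Space d → ℝ} {Ω₀ : Type*} [MeasurableSpace Ω₀]
    {P₀ : Measure Ω₀} {Z : closedCube d → Ω₀ → ℝ} (hZ : IsStationaryGaussianField C Z P₀) (r : ℝ) :
    ∃ M : ℝ, 0 ≤ M ∧ ∀ (m : Fin d → ℕ), (∀ i, 0 < m i) →
      ∀ {Ω : Type*} [MeasurableSpace Ω] (P : Measure Ω) (X : Ω → GridIdx m → ℝ),
      HasGaussianLaw X P → (∀ a, ∫ ω, X ω a ∂P = 0) →
      (∀ a b, ∫ ω, X ω a * X ω b ∂P =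
        C (gridPoint m (fun i => (a i : ℕ)) - gridPoint m fun i => (b i : ℕ))) →
      Integrable (fun ω => Real.exp (r * ‖X ω‖)) P ∧ ∫ ω, Real.exp (r * ‖X ω‖) ∂P ≤ M := by
  obtain ⟨n, hn⟩ := exists_measure_bounded hZ
  obtain ⟨κ, hκ, M, hM⟩ := lintegral_exp_norm_sq_le (n + 1) (by positivity)
  refine ⟨Real.exp (r ^ 2 / (4 * κ)) * M, by positivity, ?_⟩
  intro m hm Ω _ P X hX hX0 hcov
  let g : GridIdx m → closedCube d := fun a =>
    ⟨gridPoint m fun i => (a i : ℕ), gridPoint_mem_closedCube hm a⟩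
  let Y : Ω₀ → GridIdx m → ℝ := fun ω a => Z (g a) ω
  have hY : HasGaussianLaw Y P₀ := by
    have h := (hZ.gaussian.comp_right g).hasGaussianLaw Finset.univ
    exact h.map_fun (ContinuousLinearMap.pi fun a : GridIdx m =>
      ContinuousLinearMap.proj (R := ℝ) (φ := fun _ : (Finset.univ : Finset (GridIdx m)) => ℝ)
        ⟨a, Finset.mem_univ a⟩)
  have hlaw : P.map X = P₀.map Y := map_eq_map_of_covariance hX hY hX0
    (fun a => hZ.mean_zero (g a)) fun a b => by rw [hcov a b]; exact (hZ.cov (g a) (g b)).symm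
  have := hX.isGaussian_map
  have hXm := hX.aemeasurable
  have := hX.isProbabilityMeasure
  have hball : 3 / 4 ≤ (P.map X) {x | ‖x‖ ≤ (n : ℝ) + 1} := by
    rw [hlaw, Measure.map_apply_of_aemeasurable hY.aemeasurable
      (measurableSet_le measurable_norm measurable_const)]
    refine hn.trans (measure_mono fun ω hω => ?_)
    exact (pi_norm_le_iff_of_nonneg (by positivity)).mpr fun a => (hω (g a)).trans (by simp)
  have hmean : ∫ x, x ∂(P.map X) = 0 := by
    have hi := hX.integrable
    rw [integral_map (f := fun x => x) hXm aestronglyMeasurable_id]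
    funext a
    rw [Pi.zero_apply, ← hX0 a]
    exact ((ContinuousLinearMap.proj (R := ℝ) (φ := fun _ : GridIdx m => ℝ) a).integral_comp_comm
      hi).symm
  have hlint : ∫⁻ ω, .ofReal (Real.exp (κ * ‖X ω‖ ^ 2)) ∂P ≤ M := by
    have h := hM (P.map X) hmean hball
    rwa [lintegral_map' (by fun_prop) hXm] at h
  have hmeas : AEStronglyMeasurable (fun ω => Real.exp (κ * ‖X ω‖ ^ 2)) P :=
    (Measurable.comp_aemeasurable (g := fun x : GridIdx m → ℝ => Real.exp (κ * ‖x‖ ^ 2))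
      (by fun_prop) hXm).aestronglyMeasurable
  have hint : Integrable (fun ω => Real.exp (κ * ‖X ω‖ ^ 2)) P := by
    refine ⟨hmeas, ?_⟩
    rw [hasFiniteIntegral_iff_ofReal (Filter.Eventually.of_forall fun ω => (Real.exp_pos _).le)]
    exact hlint.trans_lt ENNReal.coe_lt_top
  have hle : ∀ ω, Real.exp (r * ‖X ω‖) ≤
      Real.exp (r ^ 2 / (4 * κ)) * Real.exp (κ * ‖X ω‖ ^ 2) := fun ω => exp_mul_le_exp_sq hκ r _
  have hint' : Integrable (fun ω => Real.exp (r * ‖X ω‖)) P := by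
    refine (hint.const_mul (Real.exp (r ^ 2 / (4 * κ)))).mono'
      (Measurable.comp_aemeasurable (g := fun x : GridIdx m → ℝ => Real.exp (r * ‖x‖))
        (by fun_prop) hXm).aestronglyMeasurable (Filter.Eventually.of_forall fun ω => ?_)
    rw [Real.norm_eq_abs, Real.abs_exp]
    exact hle ω
  refine ⟨hint', ?_⟩
  calc ∫ ω, Real.exp (r * ‖X ω‖) ∂P
      ≤ ∫ ω, Real.exp (r ^ 2 / (4 * κ)) * Real.exp (κ * ‖X ω‖ ^ 2) ∂P :=
        integral_mono hint' (hint.const_mul _) hle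
    _ = Real.exp (r ^ 2 / (4 * κ)) * ∫ ω, Real.exp (κ * ‖X ω‖ ^ 2) ∂P := integral_const_mul _ _
    _ ≤ Real.exp (r ^ 2 / (4 * κ)) * M := by
        gcongr
        rw [integral_eq_lintegral_of_nonneg_ae
          (Filter.Eventually.of_forall fun ω => (Real.exp_pos _).le) hmeas]
        exact ENNReal.toReal_le_coe_of_le_coe hlint

/-! ### The samples of circulant embedding -/

section Sample

variable {d : ℕ} {C : Space d → ℝ} {φ : ℝ → ℝ} {m : Fin d → ℕ} {J : Fin d → ℕ}
  {Ω : Type*} [MeasurableSpace Ω] {P : Measure Ω} {ξ : EmbIdx m J → Ω → ℝ}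

lemma integral_mul_of_iid {ι : Type*} [DecidableEq ι] {ξ : ι → Ω → ℝ}
    (hξ : ∀ q, HasLaw (ξ q) (gaussianReal 0 1) P) (hind : iIndepFun ξ P) (q r : ι) :
    ∫ ω, ξ q ω * ξ r ω ∂P = if q = r then 1 else 0 := by
  have hmean : ∀ q, ∫ ω, ξ q ω ∂P = 0 := fun q => by
    rw [(hξ q).integral_eq, integral_id_gaussianReal]
  split_ifs with h
  · subst h
    have hv := (hξ q).variance_eq
    rw [variance_of_integral_eq_zero (hξ q).aemeasurable (hmean q), variance_id_gaussianReal] at hv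
    simpa [sq] using hv
  · rw [(hind.indepFun h).integral_fun_mul_eq_mul_integral
      (hξ q).aemeasurable.aestronglyMeasurable (hξ r).aemeasurable.aestronglyMeasurable, hmean,
      zero_mul]

lemma embSample_continuous (hm : ∀ i, 0 < m i) (lam : EmbIdx m J → ℝ) :
    Continuous (embSample J hm lam) := by
  refine continuous_pi fun a => ?_
  simp only [embSample_apply]
  fun_prop

lemma embSample_aemeasurable (hm : ∀ i, 0 < m i) (lam : EmbIdx m J → ℝ)
    (hξ : ∀ q, HasLaw (ξ q) (gaussianReal 0 1) P) :
    AEMeasurable (fun ω => embSample J hm lam fun q => ξ q ω) P :=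
  (embSample_continuous hm lam).measurable.comp_aemeasurable
    (aemeasurable_pi_lambda _ fun q => (hξ q).aemeasurable)

lemma embSample_hasGaussianLaw (hm : ∀ i, 0 < m i) (lam : EmbIdx m J → ℝ)
    (hξ : ∀ q, HasLaw (ξ q) (gaussianReal 0 1) P) (hind : iIndepFun ξ P) :
    HasGaussianLaw (fun ω => embSample J hm lam fun q => ξ q ω) P := by
  have h := hind.hasGaussianLaw fun q => (hξ q).hasGaussianLaw
  let L : (EmbIdx m J → ℝ) →L[ℝ] (GridIdx m → ℝ) := ContinuousLinearMap.pi fun a =>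
    ∑ q, (hartleyMatrix m J (gridEmb J hm a) q * √(lam q)) •
      ContinuousLinearMap.proj (R := ℝ) (φ := fun _ : EmbIdx m J => ℝ) q
  have hL : ∀ x, embSample J hm lam x = L x := fun x => by
    funext a
    simp [L, embSample_apply]
  simp only [hL]
  exact h.map_fun L

lemma integral_embSample (hm : ∀ i, 0 < m i) (lam : EmbIdx m J → ℝ)
    (hξ : ∀ q, HasLaw (ξ q) (gaussianReal 0 1) P) (a : GridIdx m) :
    ∫ ω, embSample J hm lam (fun q => ξ q ω) a ∂P = 0 := by
  simp only [embSample_apply]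
  rw [integral_finsetSum]
  · refine Finset.sum_eq_zero fun q _ => ?_
    rw [integral_const_mul, (hξ q).integral_eq, integral_id_gaussianReal, mul_zero]
  · exact fun q _ => ((hξ q).hasGaussianLaw.integrable).const_mul _

/-- The sample `(G Λ^{1/2} ξ)_R` has the covariance matrix of the field on the grid. -/
lemma integral_embSample_mul (hm : ∀ i, 0 < m i)
    (hCsymm : ∀ x ∈ diffCube d, C (WithLp.toLp 2 fun i => |x i|) = C x)
    (hS : (embMatrix C φ m J).PosSemidef)
    (hξ : ∀ q, HasLaw (ξ q) (gaussianReal 0 1) P) (hind : iIndepFun ξ P) (a b : GridIdx m) :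
    ∫ ω, embSample J hm (embEigenvalue C φ m J) (fun q => ξ q ω) a *
      embSample J hm (embEigenvalue C φ m J) (fun q => ξ q ω) b ∂P =
      C (gridPoint m (fun i => (a i : ℕ)) - gridPoint m fun i => (b i : ℕ)) := by
  have hprod : ∀ q r, Integrable (fun ω => ξ q ω * ξ r ω) P := fun q r =>
    (hξ q).hasGaussianLaw.memLp_two.integrable_mul (hξ r).hasGaussianLaw.memLp_two
  have hexp : ∀ ω, embSample J hm (embEigenvalue C φ m J) (fun q => ξ q ω) a *
      embSample J hm (embEigenvalue C φ m J) (fun q => ξ q ω) b =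
      ∑ q, ∑ r, (hartleyMatrix m J (gridEmb J hm a) q * √(embEigenvalue C φ m J q)) *
        (hartleyMatrix m J (gridEmb J hm b) r * √(embEigenvalue C φ m J r)) *
        (ξ q ω * ξ r ω) := fun ω => by
    rw [embSample_apply, embSample_apply, Finset.sum_mul_sum]
    exact Finset.sum_congr rfl fun q _ => Finset.sum_congr rfl fun r _ => by ring
  simp only [hexp]
  rw [integral_finsetSum _ fun q _ => integrable_finsetSum _ fun r _ => (hprod q r).const_mul _,
    ← embMatrix_gridEmb (φ := φ) C J hm hCsymm, ← sum_hartleyMatrix_embEigenvalue C φ J hm]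
  refine Finset.sum_congr rfl fun q _ => ?_
  rw [integral_finsetSum _ fun r _ => (hprod q r).const_mul _]
  simp only [integral_const_mul, integral_mul_of_iid hξ hind, mul_ite, mul_one, mul_zero,
    Finset.sum_ite_eq, Finset.mem_univ, if_true]
  rw [mul_mul_mul_comm, Real.mul_self_sqrt (embEigenvalue_nonneg C φ J hm hS q)]

/-- The signs that flip the random variables belonging to the dropped eigenvalues. -/
noncomputable def dropSign (e : Fin (embSize m J) ≃ EmbIdx m J) (k : ℕ) (q : EmbIdx m J) : ℝ :=
  if (e.symm q : ℕ) + k < embSize m J then 1 else -1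

lemma hasLaw_dropSign_mul (e : Fin (embSize m J) ≃ EmbIdx m J) (k : ℕ)
    (hξ : ∀ q, HasLaw (ξ q) (gaussianReal 0 1) P) (q : EmbIdx m J) :
    HasLaw (fun ω => dropSign e k q * ξ q ω) (gaussianReal 0 1) P := by
  unfold dropSign
  split_ifs
  · simpa using hξ q
  · simpa [Pi.neg_def] using gaussianReal_neg (hξ q)

lemma iIndepFun_dropSign_mul (e : Fin (embSize m J) ≃ EmbIdx m J) (k : ℕ)
    (hind : iIndepFun ξ P) : iIndepFun (fun q ω => dropSign e k q * ξ q ω) P :=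
  hind.comp (fun q x => dropSign e k q * x) fun _ => measurable_const_mul _

/-- Dropping eigenvalues averages the sample with the one in which the dropped random variables have
the opposite sign. -/
lemma embSample_dropLast (hm : ∀ i, 0 < m i) (lam : EmbIdx m J → ℝ)
    (e : Fin (embSize m J) ≃ EmbIdx m J) (k : ℕ) (x : EmbIdx m J → ℝ) :
    embSample J hm (dropLast e k lam) x = (1 / 2 : ℝ) •
      (embSample J hm lam x + embSample J hm lam fun q => dropSign e k q * x q) := by
  funext a
  simp only [Pi.smul_apply, Pi.add_apply, embSample_apply, smul_eq_mul, ← Finset.sum_add_distrib,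
    Finset.mul_sum]
  refine Finset.sum_congr rfl fun q _ => ?_
  unfold dropLast dropSign
  split_ifs
  · ring
  · rw [Real.sqrt_zero]; ring

lemma exp_norm_half_add_le {E : Type*} [NormedAddCommGroup E] [NormedSpace ℝ E] {r : ℝ}
    (hr : 0 ≤ r) (x y : E) : Real.exp (r * ‖(1 / 2 : ℝ) • (x + y)‖) ≤
      (Real.exp (r * ‖x‖) + Real.exp (r * ‖y‖)) / 2 := by
  have h1 : r * ‖(1 / 2 : ℝ) • (x + y)‖ ≤ r * ‖x‖ / 2 + r * ‖y‖ / 2 := by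
    rw [norm_smul, Real.norm_of_nonneg (by norm_num)]
    nlinarith [norm_add_le x y]
  have h2 : ∀ t : ℝ, Real.exp t = Real.exp (t / 2) ^ 2 := fun t => by
    rw [← Real.exp_nat_mul]; congr 1; push_cast; ring
  refine (Real.exp_le_exp.mpr h1).trans ?_
  rw [Real.exp_add, h2 (r * ‖x‖), h2 (r * ‖y‖)]
  nlinarith [sq_nonneg (Real.exp (r * ‖x‖ / 2) - Real.exp (r * ‖y‖ / 2))]

/-- The positions of the dropped eigenvalues. -/
def dropped (e : Fin (embSize m J) ≃ EmbIdx m J) (k : ℕ) : Finset (EmbIdx m J) :=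
  Finset.univ.filter fun q => embSize m J ≤ (e.symm q : ℕ) + k

lemma card_dropped_le (e : Fin (embSize m J) ≃ EmbIdx m J) (k : ℕ) :
    (dropped e k).card ≤ k := by
  have h : ((dropped e k).image fun q => (e.symm q : ℕ)) ⊆
      Finset.Ico (embSize m J - k) (embSize m J) := by
    intro j hj
    obtain ⟨q, hq, rfl⟩ := Finset.mem_image.mp hj
    have hq := (Finset.mem_filter.mp hq).2
    have := (e.symm q).isLt
    rw [Finset.mem_Ico]
    omega
  have h2 := Finset.card_le_card h
  rw [Finset.card_image_of_injective _ fun q r hqr => e.symm.injective (Fin.ext hqr),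
    Nat.card_Ico] at h2
  omega

/-- The pathwise effect of dropping eigenvalues. -/
lemma norm_embSample_sub_dropLast_le (hm : ∀ i, 0 < m i) (lam : EmbIdx m J → ℝ)
    (e : Fin (embSize m J) ≃ EmbIdx m J) (k : ℕ) (x : EmbIdx m J → ℝ) :
    ‖embSample J hm lam x - embSample J hm (dropLast e k lam) x‖ ≤
      2 * (√(embSize m J : ℝ))⁻¹ *
        (⨆ j : {j : Fin (embSize m J) // embSize m J ≤ (j : ℕ) + k}, √(lam (e j))) *
        ∑ q ∈ dropped e k, |x q| := by
  set M := ⨆ j : {j : Fin (embSize m J) // embSize m J ≤ (j : ℕ) + k}, √(lam (e j)) with hM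
  have hM0 : 0 ≤ M := Real.iSup_nonneg fun j => Real.sqrt_nonneg _
  refine (pi_norm_le_iff_of_nonneg (mul_nonneg (by positivity)
    (Finset.sum_nonneg fun _ _ => abs_nonneg _))).mpr fun a => ?_
  have hdiff : (embSample J hm lam x - embSample J hm (dropLast e k lam) x) a =
      ∑ q ∈ dropped e k, hartleyMatrix m J (gridEmb J hm a) q * √(lam q) * x q := by
    rw [Pi.sub_apply, embSample_apply, embSample_apply, ← Finset.sum_sub_distrib, dropped,
      Finset.sum_filter]
    refine Finset.sum_congr rfl fun q _ => ?_
    unfold dropLast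
    by_cases h : (e.symm q : ℕ) + k < embSize m J
    · rw [if_pos h, if_neg (not_le.mpr h), sub_self]
    · rw [if_neg h, if_pos (not_lt.mp h), Real.sqrt_zero]; ring
  rw [hdiff, Finset.mul_sum]
  refine (norm_sum_le _ _).trans (Finset.sum_le_sum fun q hq => ?_)
  have hq' : embSize m J ≤ (e.symm q : ℕ) + k := (Finset.mem_filter.mp hq).2
  have hle : √(lam q) ≤ M := by
    have := le_ciSup (f := fun j : {j : Fin (embSize m J) // embSize m J ≤ (j : ℕ) + k} =>
      √(lam (e j))) (Set.finite_range _).bddAbove ⟨e.symm q, hq'⟩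
    simpa using this
  rw [norm_mul, norm_mul, Real.norm_eq_abs, Real.norm_eq_abs, Real.norm_eq_abs,
    abs_of_nonneg (Real.sqrt_nonneg _)]
  gcongr
  exact abs_hartleyMatrix_le J hm _ _

/-- The moments of the sum of the moduli of the dropped variables. -/
lemma moment_sum_dropped_le (e : Fin (embSize m J) ≃ EmbIdx m J) {k : ℕ}
    (hξ : ∀ q, HasLaw (ξ q) (gaussianReal 0 1) P) {r : ℝ} (hr : 1 ≤ r) (hk : 0 < k) :
    Integrable (fun ω => ((∑ q ∈ dropped e k, |ξ q ω|) / k) ^ r) P ∧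
      ∫ ω, ((∑ q ∈ dropped e k, |ξ q ω|) / k) ^ r ∂P ≤ ∫ x, |x| ^ r ∂(gaussianReal 0 1) := by
  have hk' : (0 : ℝ) < k := mod_cast hk
  have hr0 : 0 < r := by linarith
  have hmeas : AEStronglyMeasurable (fun x : ℝ => |x| ^ r) (gaussianReal 0 1) :=
    Measurable.aestronglyMeasurable (by fun_prop)
  have hI : Integrable (fun x : ℝ => |x| ^ r) (gaussianReal 0 1) := by
    have h := (memLp_id_gaussianReal' (μ := 0) (v := 1) (ENNReal.ofReal r) (by simp)).integrable_norm_rpow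
      (by simpa using hr0) (by simp)
    simpa [ENNReal.toReal_ofReal hr0.le] using h
  have hIq : ∀ q, Integrable (fun ω => |ξ q ω| ^ r) P := fun q => by
    have := (hξ q).map_eq ▸ hI
    exact (integrable_map_measure ((hξ q).map_eq ▸ hmeas) (hξ q).aemeasurable).mp this
  have hEq : ∀ q, ∫ ω, |ξ q ω| ^ r ∂P = ∫ x, |x| ^ r ∂(gaussianReal 0 1) := fun q =>
    (hξ q).integral_comp hmeas
  have hbound : ∀ ω, ((∑ q ∈ dropped e k, |ξ q ω|) / k) ^ r ≤
      (k : ℝ)⁻¹ * ∑ q ∈ dropped e k, |ξ q ω| ^ r := fun ω => by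
    have hS : 0 ≤ ∑ q ∈ dropped e k, |ξ q ω| ^ r :=
      Finset.sum_nonneg fun _ _ => Real.rpow_nonneg (abs_nonneg _) _
    rw [Real.div_rpow (Finset.sum_nonneg fun _ _ => abs_nonneg _) hk'.le]
    have h1 := Real.rpow_sum_le_const_mul_sum_rpow (dropped e k) (fun q => ξ q ω) hr
    have h2 : ((dropped e k).card : ℝ) ^ (r - 1) ≤ (k : ℝ) ^ (r - 1) :=
      Real.rpow_le_rpow (by positivity) (mod_cast card_dropped_le e k) (by linarith)
    rw [div_le_iff₀ (by positivity)]
    calc _ ≤ _ := h1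
      _ ≤ (k : ℝ) ^ (r - 1) * ∑ q ∈ dropped e k, |ξ q ω| ^ r := by gcongr
      _ = _ := by rw [Real.rpow_sub_one hk'.ne']; field_simp
  have hIsum : Integrable (fun ω => (k : ℝ)⁻¹ * ∑ q ∈ dropped e k, |ξ q ω| ^ r) P :=
    (integrable_finsetSum _ fun q _ => hIq q).const_mul _
  have hm' : AEStronglyMeasurable (fun ω => ((∑ q ∈ dropped e k, |ξ q ω|) / k) ^ r) P := by
    have : ∀ q, AEMeasurable (ξ q) P := fun q => (hξ q).aemeasurable
    refine AEMeasurable.aestronglyMeasurable ?_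
    refine ((Finset.aemeasurable_fun_sum _ fun q _ => ?_).div_const _).pow_const _
    exact (measurable_abs.comp_aemeasurable (this q))
  have hint : Integrable (fun ω => ((∑ q ∈ dropped e k, |ξ q ω|) / k) ^ r) P := by
    refine hIsum.mono' hm' (Filter.Eventually.of_forall fun ω => ?_)
    rw [Real.norm_of_nonneg (Real.rpow_nonneg (div_nonneg
      (Finset.sum_nonneg fun _ _ => abs_nonneg _) hk'.le) _)]
    exact hbound ω
  refine ⟨hint, (integral_mono hint hIsum hbound).trans ?_⟩
  rw [integral_const_mul, integral_finsetSum _ fun q _ => hIq q]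
  simp only [hEq, Finset.sum_const, nsmul_eq_mul]
  rw [← mul_assoc]
  refine mul_le_of_le_one_left (integral_nonneg fun x => Real.rpow_nonneg (abs_nonneg _) _) ?_
  rw [inv_mul_le_iff₀ hk', mul_one]
  exact_mod_cast card_dropped_le e k

end Sample

/-- Uniform bounds for the exponential moments of the sample and of the smoothed sample. -/
lemma exists_embSample_moment_bound {d : ℕ} {C : Space d → ℝ}
    (hCsymm : ∀ x ∈ diffCube d, C (WithLp.toLp 2 fun i => |x i|) = C x)
    {Ω₀ : Type*} [MeasurableSpace Ω₀]
    {P₀ : Measure Ω₀} {Z : closedCube d → Ω₀ → ℝ} (hZ : IsStationaryGaussianField C Z P₀)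
    {r : ℝ} (hr : 0 ≤ r) :
    ∃ M : ℝ, 0 ≤ M ∧ ∀ (m J : Fin d → ℕ) (hm : ∀ i, 0 < m i) (φ : ℝ → ℝ),
      (embMatrix C φ m J).PosSemidef →
      ∀ (e : Fin (embSize m J) ≃ EmbIdx m J) (k : ℕ)
        {Ω : Type*} [MeasurableSpace Ω] (P : Measure Ω) (ξ : EmbIdx m J → Ω → ℝ),
        (∀ q, HasLaw (ξ q) (gaussianReal 0 1) P) → iIndepFun ξ P →
        (Integrable (fun ω =>
          Real.exp (r * ‖embSample J hm (embEigenvalue C φ m J) fun q => ξ q ω‖)) P ∧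
        ∫ ω, Real.exp (r * ‖embSample J hm (embEigenvalue C φ m J) fun q => ξ q ω‖) ∂P ≤ M) ∧
        (Integrable (fun ω => Real.exp
          (r * ‖embSample J hm (dropLast e k (embEigenvalue C φ m J)) fun q => ξ q ω‖)) P ∧
        ∫ ω, Real.exp
          (r * ‖embSample J hm (dropLast e k (embEigenvalue C φ m J)) fun q => ξ q ω‖) ∂P ≤ M) := by
  obtain ⟨M, hM0, hM⟩ := exists_exp_moment_bound hZ r
  refine ⟨M, hM0, ?_⟩
  intro m J hm φ hS e k Ω _ P ξ hξ hind
  have key : ∀ η : EmbIdx m J → Ω → ℝ, (∀ q, HasLaw (η q) (gaussianReal 0 1) P) →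
      iIndepFun η P → Integrable (fun ω =>
          Real.exp (r * ‖embSample J hm (embEigenvalue C φ m J) fun q => η q ω‖)) P ∧
        ∫ ω, Real.exp (r * ‖embSample J hm (embEigenvalue C φ m J) fun q => η q ω‖) ∂P ≤ M :=
    fun η hη hind => hM m hm P _ (embSample_hasGaussianLaw hm _ hη hind)
      (integral_embSample hm _ hη) (integral_embSample_mul hm hCsymm hS hη hind)
  obtain ⟨h1, h2⟩ := key ξ hξ hind
  obtain ⟨h3, h4⟩ := key _ (hasLaw_dropSign_mul e k hξ) (iIndepFun_dropSign_mul e k hind)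
  have hbound : ∀ ω, Real.exp
      (r * ‖embSample J hm (dropLast e k (embEigenvalue C φ m J)) fun q => ξ q ω‖) ≤
      (Real.exp (r * ‖embSample J hm (embEigenvalue C φ m J) fun q => ξ q ω‖) +
        Real.exp (r * ‖embSample J hm (embEigenvalue C φ m J) fun q =>
          dropSign e k q * ξ q ω‖)) / 2 := fun ω => by
    rw [embSample_dropLast]
    exact exp_norm_half_add_le hr _ _
  have hI := (h1.add h3).div_const 2
  have hint : Integrable (fun ω => Real.exp
      (r * ‖embSample J hm (dropLast e k (embEigenvalue C φ m J)) fun q => ξ q ω‖)) P := by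
    refine hI.mono' ?_ (Filter.Eventually.of_forall fun ω => ?_)
    · exact (Measurable.comp_aemeasurable
        (g := fun x : GridIdx m → ℝ => Real.exp (r * ‖x‖)) (by fun_prop)
        (embSample_aemeasurable hm _ hξ)).aestronglyMeasurable
    · rw [Real.norm_eq_abs, Real.abs_exp]
      exact hbound ω
  refine ⟨⟨h1, h2⟩, hint, (integral_mono hint hI hbound).trans ?_⟩
  simp only [Pi.add_apply]
  rw [integral_div, integral_add h1 h3]
  linarith

/-! ### Galerkin problems for weighted sums of positive semidefinite forms -/

section Galerkin

variable {E ι : Type*} [NormedAddCommGroup E] [NormedSpace ℝ E] {T : Finset ι}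
  {B : ι → LinearMap.BilinForm ℝ E} {κ : ℝ}

lemma norm_sq_le_mul_sum_weighted (hpos : ∀ t x, 0 ≤ B t x x)
    (hcoer : ∀ v, ‖v‖ ^ 2 ≤ κ ^ 2 * ∑ t ∈ T, B t v v) {c : ι → ℝ} {α : ℝ} (hα : 0 < α)
    (hc : ∀ t ∈ T, α ≤ c t) (v : E) :
    ‖v‖ ^ 2 ≤ κ ^ 2 * α⁻¹ * ∑ t ∈ T, c t * B t v v := by
  have h : α * ∑ t ∈ T, B t v v ≤ ∑ t ∈ T, c t * B t v v := by
    rw [Finset.mul_sum]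
    exact Finset.sum_le_sum fun t ht => mul_le_mul_of_nonneg_right (hc t ht) (hpos t v)
  refine (hcoer v).trans ?_
  rw [mul_assoc]
  gcongr
  rwa [le_inv_mul_iff₀ hα]

/-- Coercivity makes the discrete problem uniquely solvable; in finite dimensions only injectivity
has to be checked. -/
lemma exists_galerkin_solution (V : Submodule ℝ E) [FiniteDimensional ℝ V]
    (hpos : ∀ t x, 0 ≤ B t x x) (hcoer : ∀ v, ‖v‖ ^ 2 ≤ κ ^ 2 * ∑ t ∈ T, B t v v)
    {c : ι → ℝ} {α : ℝ} (hα : 0 < α) (hc : ∀ t ∈ T, α ≤ c t) (f : E →L[ℝ] ℝ) :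
    ∃ u ∈ V, ∀ v ∈ V, ∑ t ∈ T, c t * B t u v = f v := by
  let A : V →ₗ[ℝ] Module.Dual ℝ V :=
    LinearMap.BilinForm.restrict (∑ t ∈ T, c t • B t) V
  have hA : ∀ u v : V, A u v = ∑ t ∈ T, c t * B t u v := fun u v => by
    simp [A, LinearMap.BilinForm.restrict_apply, LinearMap.sum_apply]
  have hinj : Function.Injective A := by
    rw [← LinearMap.ker_eq_bot, LinearMap.ker_eq_bot']
    intro u hu
    have h1 := norm_sq_le_mul_sum_weighted hpos hcoer hα hc (u : E)
    rw [← hA u u, hu] at h1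
    have h2 : ‖(u : E)‖ ^ 2 ≤ 0 := by simpa using h1
    have h3 : ‖(u : E)‖ = 0 := by nlinarith [norm_nonneg (u : E)]
    exact Subtype.ext (norm_eq_zero.mp h3)
  have hsurj : Function.Surjective A :=
    (LinearMap.injective_iff_surjective_of_finrank_eq_finrank
      (Subspace.dual_finrank_eq (K := ℝ) (V := V)).symm).mp hinj
  obtain ⟨u, hu⟩ := hsurj (f.toLinearMap.domRestrict V)
  exact ⟨u, u.2, fun v hv => by rw [← hA u ⟨v, hv⟩, hu]; rfl⟩

/-- Lipschitz dependence of the Galerkin solution on the weights. -/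
lemma norm_galerkin_sub_le (V : Submodule ℝ E) (hpos : ∀ t x, 0 ≤ B t x x)
    (hsymm : ∀ t x y, B t x y = B t y x) (hκ : 0 ≤ κ)
    (hcoer : ∀ v, ‖v‖ ^ 2 ≤ κ ^ 2 * ∑ t ∈ T, B t v v)
    {c c' : ι → ℝ} {α α' δ : ℝ} (hα : 0 < α) (hc : ∀ t ∈ T, α ≤ c t)
    (hα' : 0 < α') (hc' : ∀ t ∈ T, α' ≤ c' t) (hδ : ∀ t ∈ T, |c t - c' t| ≤ δ) (hδ0 : 0 ≤ δ)
    (f : E →L[ℝ] ℝ) {u u' : E} (hu : u ∈ V) (hu' : u' ∈ V)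
    (hsol : ∀ v ∈ V, ∑ t ∈ T, c t * B t u v = f v)
    (hsol' : ∀ v ∈ V, ∑ t ∈ T, c' t * B t u' v = f v) :
    ‖u - u'‖ ≤ κ ^ 2 * ‖f‖ * (α⁻¹ * α'⁻¹ * δ) := by
  let N : E → ℝ := fun v => √(∑ t ∈ T, B t v v)
  have hN0 : ∀ v, 0 ≤ N v := fun v => Real.sqrt_nonneg _
  have hNsq : ∀ v, N v ^ 2 = ∑ t ∈ T, B t v v := fun v =>
    Real.sq_sqrt (Finset.sum_nonneg fun t _ => hpos t v)
  have hnorm : ∀ v, ‖v‖ ≤ κ * N v := fun v => by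
    refine abs_le_of_sq_le_sq' ?_ (mul_nonneg hκ (hN0 v)) |>.2
    rw [mul_pow, hNsq]
    exact hcoer v
  have hCS : ∀ v w, ∑ t ∈ T, |B t v w| ≤ N v * N w := fun v w => by
    refine le_trans (Finset.sum_le_sum fun t _ => ?_)
      (Real.sum_sqrt_mul_sqrt_le T (fun t => hpos t v) (fun t => hpos t w))
    rw [← Real.sqrt_mul (hpos t v)]
    refine Real.abs_le_sqrt ?_
    rw [sq]
    nth_rewrite 2 [hsymm t v w]
    exact (B t).apply_mul_apply_le_of_forall_zero_le (hpos t) v w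
  have hlow : ∀ {c : ι → ℝ} {α : ℝ}, (∀ t ∈ T, α ≤ c t) → ∀ v,
      α * N v ^ 2 ≤ ∑ t ∈ T, c t * B t v v := fun {c α} hc v => by
    rw [hNsq, Finset.mul_sum]
    exact Finset.sum_le_sum fun t ht => mul_le_mul_of_nonneg_right (hc t ht) (hpos t v)
  -- energy bound for `u'`
  have hu'N : α' * N u' ≤ ‖f‖ * κ := by
    have h1 := hlow hc' u'
    rw [hsol' u' hu'] at h1
    have h2 : f u' ≤ ‖f‖ * (κ * N u') :=
      (le_abs_self _).trans ((f.le_opNorm u').trans (by gcongr; exact hnorm u'))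
    rcases (hN0 u').eq_or_lt with h0 | h0
    · rw [← h0]; simpa using mul_nonneg (norm_nonneg f) hκ
    · exact le_of_mul_le_mul_right (by nlinarith) h0
  -- the error satisfies the equation for `u` with the perturbation as right-hand side
  set w := u - u' with hw
  have hwV : w ∈ V := V.sub_mem hu hu'
  have hwN : α * N w ≤ δ * N u' := by
    have h1 := hlow hc w
    have h2 : ∑ t ∈ T, c t * B t w w = ∑ t ∈ T, (c' t - c t) * B t u' w := by
      have h3 : ∑ t ∈ T, c t * B t w w =
          ∑ t ∈ T, c t * B t u w - ∑ t ∈ T, c t * B t u' w := by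
        rw [← Finset.sum_sub_distrib]
        refine Finset.sum_congr rfl fun t _ => ?_
        rw [← mul_sub, ← LinearMap.sub_apply, ← map_sub]
      rw [h3, hsol w hwV, ← hsol' w hwV, ← Finset.sum_sub_distrib]
      exact Finset.sum_congr rfl fun t _ => (sub_mul _ _ _).symm
    have h4 : ∑ t ∈ T, (c' t - c t) * B t u' w ≤ δ * (N u' * N w) := by
      calc ∑ t ∈ T, (c' t - c t) * B t u' w ≤ ∑ t ∈ T, δ * |B t u' w| := by
            refine Finset.sum_le_sum fun t ht => (le_abs_self _).trans ?_
            rw [abs_mul, abs_sub_comm]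
            gcongr
            exact hδ t ht
        _ = δ * ∑ t ∈ T, |B t u' w| := (Finset.mul_sum _ _ _).symm
        _ ≤ δ * (N u' * N w) := by gcongr; exact hCS u' w
    rcases (hN0 w).eq_or_lt with h0 | h0
    · rw [← h0]; simpa using mul_nonneg hδ0 (hN0 u')
    · exact le_of_mul_le_mul_right (by nlinarith) h0
  calc ‖w‖ ≤ κ * N w := hnorm w
    _ ≤ κ * (α⁻¹ * (δ * (α'⁻¹ * (‖f‖ * κ)))) := by
        gcongr
        rw [le_inv_mul_iff₀ hα]
        refine hwN.trans ?_
        gcongr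
        rwa [le_inv_mul_iff₀ hα']
    _ = κ ^ 2 * ‖f‖ * (α⁻¹ * α'⁻¹ * δ) := by ring

end Galerkin

/-! ### The Poincaré inequality on `H^1_0(D)` -/

lemma isOpen_openCube (d : ℕ) : IsOpen (openCube d) := by
  have h : openCube d = ⋂ i, {x : Space d | 0 < x i ∧ x i < 1} := by
    ext x
    simp [openCube]
  rw [h]
  refine isOpen_iInter_of_finite fun i => ?_
  have hi : Continuous fun x : Space d => x i := by fun_prop
  exact (isOpen_lt continuous_const hi).inter (isOpen_lt hi continuous_const)

lemma norm_sq_eq_H1val_H1grad {d : ℕ} (u : H1 d) : ‖u‖ ^ 2 = ‖H1val u‖ ^ 2 + ‖H1grad u‖ ^ 2 :=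
  WithLp.prod_norm_sq_eq_of_L2 _

lemma continuous_H1val (d : ℕ) : Continuous (H1val : H1 d → _) :=
  (WithLp.prod_continuous_ofLp 2 _ _).fst.comp continuous_subtype_val

lemma continuous_H1grad (d : ℕ) : Continuous (H1grad : H1 d → _) :=
  (WithLp.prod_continuous_ofLp 2 _ _).snd.comp continuous_subtype_val

lemma IsTest.coord_mul {d : ℕ} {φ : Space d → ℝ} (hφ : IsTest φ) (i : Fin d) :
    IsTest fun x => x i * φ x where
  smooth := ContDiff.mul (EuclideanSpace.proj (𝕜 := ℝ) i).contDiff hφ.smooth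
  compact := hφ.compact.mul_left
  support := (tsupport_mul_subset_right).trans hφ.support

lemma IsTest.eq_zero_of_notMem {d : ℕ} {φ : Space d → ℝ} (hφ : IsTest φ) {x : Space d}
    (hx : x ∉ openCube d) : φ x = 0 :=
  image_eq_zero_of_notMem_tsupport fun h => hx (hφ.support h)

lemma IsTest.setIntegral_mul {d : ℕ} {φ : Space d → ℝ} (hφ : IsTest φ) (g : Space d → ℝ) :
    ∫ x, φ x * g x ∂(volD d) = ∫ x, φ x * g x :=
  setIntegral_eq_integral_of_forall_compl_eq_zero fun x hx => by
    rw [hφ.eq_zero_of_notMem hx, zero_mul]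

/-- Integration by parts in `∫ φ · x_i ∂_i φ`. -/
lemma IsTest.integral_mul_fderiv_coord_mul {d : ℕ} {φ : Space d → ℝ} (hφ : IsTest φ) (i : Fin d) :
    ∫ x, φ x * fderiv ℝ (fun y => y i * φ y) x (EuclideanSpace.single i 1) ∂(volD d) =
      (∫ x, φ x * φ x ∂(volD d)) / 2 := by
  have hψ := hφ.coord_mul i
  obtain ⟨hc1, hs1⟩ := test_deriv hφ (EuclideanSpace.single i 1)
  obtain ⟨hc2, hs2⟩ := test_deriv hψ (EuclideanSpace.single i 1)
  have hdiff : ∀ x, fderiv ℝ (fun y : Space d => y i * φ y) x (EuclideanSpace.single i 1) =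
      φ x + x i * fderiv ℝ φ x (EuclideanSpace.single i 1) := fun x => by
    have h1 : HasFDerivAt (fun y : Space d => y i) (EuclideanSpace.proj (𝕜 := ℝ) i) x :=
      (EuclideanSpace.proj (𝕜 := ℝ) i).hasFDerivAt
    have h2 : HasFDerivAt φ (fderiv ℝ φ x) x :=
      (hφ.smooth.differentiable (by simp) x).hasFDerivAt
    rw [(h1.fun_mul h2).fderiv]
    simp
    ring
  have hI1 : Integrable (fun x => φ x * fderiv ℝ (fun y : Space d => y i * φ y) x
      (EuclideanSpace.single i 1)) :=
    (hφ.smooth.continuous.mul hc2).integrable_of_hasCompactSupport hφ.compact.mul_right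
  have hI2 : Integrable (fun x : Space d => (x i * φ x) *
      fderiv ℝ φ x (EuclideanSpace.single i 1)) :=
    (hψ.smooth.continuous.mul hc1).integrable_of_hasCompactSupport hψ.compact.mul_right
  have hI3 : Integrable (fun x : Space d => (x i * φ x) * φ x) :=
    (hψ.smooth.continuous.mul hφ.smooth.continuous).integrable_of_hasCompactSupport
      hψ.compact.mul_right
  have hI4 : Integrable (fun x : Space d => φ x * φ x) :=
    (hφ.smooth.continuous.mul hφ.smooth.continuous).integrable_of_hasCompactSupport
      hφ.compact.mul_right
  have hparts := integral_mul_fderiv_eq_neg_fderiv_mul_of_integrable (μ := volume)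
    (f := fun x : Space d => x i * φ x) (g := φ) (v := EuclideanSpace.single i 1)
    (by simpa only [mul_comm] using hI1) hI2 hI3
    (fun x _ => hψ.smooth.differentiable (by simp) x)
    (fun x _ => hφ.smooth.differentiable (by simp) x)
  rw [hφ.setIntegral_mul, hφ.setIntegral_mul]
  have hsum : ∫ x, φ x * fderiv ℝ (fun y : Space d => y i * φ y) x (EuclideanSpace.single i 1) =
      (∫ x, φ x * φ x) +
        ∫ x : Space d, (x i * φ x) * fderiv ℝ φ x (EuclideanSpace.single i 1) := by
    rw [← integral_add hI4 hI2]
    refine integral_congr_ae (Filter.Eventually.of_forall fun x => ?_)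
    simp only [hdiff]
    ring
  have hcomm : ∫ x : Space d, fderiv ℝ (fun y : Space d => y i * φ y) x
      (EuclideanSpace.single i 1) * φ x = ∫ x, φ x * fderiv ℝ (fun y : Space d => y i * φ y) x
      (EuclideanSpace.single i 1) := by simp only [mul_comm]
  rw [hcomm] at hparts
  linarith

/-- The Poincaré inequality for elements of `H^1(D)` represented by a test function: the weak
derivative is tested with `x_i φ`. -/
lemma norm_H1val_le_of_test {d : ℕ} (i : Fin d) (u : H1 d) {φ : Space d → ℝ} (hφ : IsTest φ)
    (huφ : H1val u =ᵐ[volD d] φ) : ‖H1val u‖ ≤ 2 * ‖H1grad u‖ := by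
  have hψ := hφ.coord_mul i
  have hweak := u.2 (fun x => x i * φ x) hψ i
  change ∫ x, (H1val u x : ℝ) * _ ∂_ = -∫ x, (H1grad u x : Space d) i * _ ∂_ at hweak
  rw [integral_congr_ae (g := fun x => φ x * fderiv ℝ (fun y : Space d => y i * φ y) x
      (EuclideanSpace.single i 1)) (by filter_upwards [huφ] with x hx; rw [hx]),
    hφ.integral_mul_fderiv_coord_mul i] at hweak
  have hsq : ‖H1val u‖ ^ 2 = ∫ x, φ x * φ x ∂(volD d) := by
    rw [← real_inner_self_eq_norm_sq, L2.inner_def]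
    refine integral_congr_ae ?_
    filter_upwards [huφ] with x hx
    rw [hx, real_inner_self_eq_norm_sq, Real.norm_eq_abs, sq_abs, sq]
  have hcont : Continuous fun x : Space d => (x i * φ x) • EuclideanSpace.single i (1 : ℝ) :=
    hψ.smooth.continuous.smul continuous_const
  have hmem : MemLp (fun x : Space d => (x i * φ x) • EuclideanSpace.single i (1 : ℝ)) 2
      (volD d) :=
    hcont.memLp_of_hasCompactSupport (hψ.compact.smul_right)
  have hinner : ⟪hmem.toLp, H1grad u⟫_ℝ = ∫ x, (H1grad u x : Space d) i * (x i * φ x) ∂(volD d) := by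
    rw [L2.inner_def]
    refine integral_congr_ae ?_
    filter_upwards [hmem.coeFn_toLp] with x hx
    rw [hx, inner_smul_left, EuclideanSpace.inner_single_left]
    simp
    ring
  have hnorm : ‖hmem.toLp‖ ≤ ‖H1val u‖ := by
    refine Lp.norm_le_norm_of_ae_le ?_
    filter_upwards [hmem.coeFn_toLp, huφ, ae_restrict_mem (isOpen_openCube d).measurableSet]
      with x hx hx2 hxD
    rw [hx, hx2, norm_smul, PiLp.norm_single, norm_one, mul_one, norm_mul]
    refine mul_le_of_le_one_left (norm_nonneg _) ?_
    rw [Real.norm_eq_abs, abs_le]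
    exact ⟨by linarith [(hxD i).1], (hxD i).2.le⟩
  have hCS := abs_real_inner_le_norm hmem.toLp (H1grad u)
  rw [hinner] at hCS
  have h1 : ‖H1val u‖ ^ 2 / 2 ≤ ‖H1val u‖ * ‖H1grad u‖ := by
    rw [hsq, hweak]
    refine (neg_le_abs _).trans (hCS.trans ?_)
    gcongr
  rcases (norm_nonneg (H1val u)).eq_or_lt with h0 | h0
  · rw [← h0]; positivity
  · nlinarith

lemma norm_H1val_le {d : ℕ} (hd : 0 < d) (u : H10 d) :
    ‖H1val (u : H1 d)‖ ≤ 2 * ‖H1grad (u : H1 d)‖ := by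
  have hclosed : IsClosed {u : H1 d | ‖H1val u‖ ≤ 2 * ‖H1grad u‖} :=
    isClosed_le (continuous_H1val d).norm (continuous_const.mul (continuous_H1grad d).norm)
  have hspan : (Submodule.span ℝ {u : H1 d | ∃ φ : Space d → ℝ, IsTest φ ∧ H1val u =ᵐ[volD d] φ} :
      Set (H1 d)) ⊆ {u : H1 d | ‖H1val u‖ ≤ 2 * ‖H1grad u‖} := by
    intro v hv
    have h : ∃ φ : Space d → ℝ, IsTest φ ∧ H1val v =ᵐ[volD d] φ := by
      refine Submodule.span_induction (fun x hx => hx) ?_ ?_ ?_ hv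
      · refine ⟨fun _ => 0, ⟨contDiff_const, HasCompactSupport.zero, ?_⟩, Lp.coeFn_zero _ _ _⟩
        simp [tsupport]
      · rintro x y _ _ ⟨φ, hφ, hx⟩ ⟨ψ, hψ, hy⟩
        refine ⟨fun z => φ z + ψ z, ⟨hφ.smooth.add hψ.smooth, hφ.compact.add hψ.compact,
          (tsupport_add φ ψ).trans (union_subset hφ.support hψ.support)⟩, ?_⟩
        filter_upwards [Lp.coeFn_add (H1val x) (H1val y), hx, hy] with z hz hz1 hz2
        exact hz.trans (by rw [Pi.add_apply, hz1, hz2])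
      · rintro a x _ ⟨φ, hφ, hx⟩
        refine ⟨fun z => a * φ z, ⟨contDiff_const.mul hφ.smooth, hφ.compact.mul_left,
          (tsupport_mul_subset_right).trans hφ.support⟩, ?_⟩
        filter_upwards [Lp.coeFn_smul a (H1val x), hx] with z hz hz1
        exact hz.trans (by rw [Pi.smul_apply, hz1, smul_eq_mul])
    obtain ⟨φ, hφ, hv⟩ := h
    exact norm_H1val_le_of_test ⟨0, hd⟩ v hφ hv
  exact closure_minimal hspan hclosed u.2

/-- On `H^1_0(D)` the full norm is controlled by the gradient. -/
lemma norm_sq_le_norm_H1grad_sq {d : ℕ} (hd : 0 < d) (u : H10 d) :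
    ‖u‖ ^ 2 ≤ 5 * ‖H1grad (u : H1 d)‖ ^ 2 := by
  have h1 := norm_H1val_le hd u
  have h2 := norm_sq_eq_H1val_H1grad (u : H1 d)
  rw [Submodule.norm_coe] at h2
  nlinarith [norm_nonneg (H1val (u : H1 d)), norm_nonneg (H1grad (u : H1 d))]

/-- The weak gradient is determined by the function. -/
lemma H1grad_eq_zero {d : ℕ} {u : H1 d} (hu : H1val u = 0) : H1grad u = 0 := by
  have hi : ∀ i, ∀ᵐ x ∂(volD d), x ∈ openCube d → (H1grad u x : Space d) i = 0 := fun i => by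
    refine (isOpen_openCube d).ae_eq_zero_of_integral_contDiff_smul_eq_zero
      (((memLp_apply (H1grad u) i).integrable (by norm_num)).locallyIntegrable.locallyIntegrableOn _)
      fun g hg hgc hgs => ?_
    have hweak := u.2 g ⟨hg, hgc, hgs⟩ i
    change ∫ x, (H1val u x : ℝ) * _ ∂_ = -∫ x, (H1grad u x : Space d) i * _ ∂_ at hweak
    rw [integral_congr_ae (g := fun _ => (0 : ℝ)) (by
      filter_upwards [Lp.coeFn_zero ℝ 2 (volD d)] with x hx
      rw [hu, hx, Pi.zero_apply, zero_mul]), integral_zero, zero_eq_neg] at hweak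
    rw [← hweak]
    simp only [smul_eq_mul, mul_comm]
  rw [Lp.eq_zero_iff_ae_eq_zero]
  filter_upwards [ae_all_iff.mpr hi, ae_restrict_mem (isOpen_openCube d).measurableSet]
    with x hx hxD
  ext i
  exact hx i hxD

/-! ### Piecewise linear finite elements -/

section FiniteElements

variable {d : ℕ} {m : Fin d → ℕ} {K : Geometry.SimplicialComplex ℝ (Space d)}

lemma gridPoint_injective (hm : ∀ i, 0 < m i) :
    Function.Injective fun a : GridIdx m => gridPoint m fun i => (a i : ℕ) := by
  intro a b hab
  funext i
  have h0 : (0 : ℝ) < m i := mod_cast hm i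
  have h := congrArg (fun x : Space d => x i) hab
  simp only [gridPoint] at h
  rw [div_left_inj' h0.ne'] at h
  exact Fin.ext (mod_cast h)

lemma finite_faces (hK : IsGridTriangulation m K) : K.faces.Finite := by
  have hv : K.vertices.Finite := hK.vertices_eq ▸ Set.finite_range _
  refine (hv.toFinset.powerset.finite_toSet).subset fun τ hτ => ?_
  rw [Finset.mem_coe, Finset.mem_powerset]
  intro x hx
  rw [Set.Finite.mem_toFinset, K.vertices_eq]
  exact mem_biUnion hτ hx

/-- The facets of a finite complex cover its space. -/
lemma exists_facet_of_mem_space (hfin : K.faces.Finite) {x : Space d} (hx : x ∈ K.space) :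
    ∃ τ ∈ K.facets, x ∈ convexHull ℝ (τ : Set (Space d)) := by
  obtain ⟨σ, hσ, hxσ⟩ := Geometry.SimplicialComplex.mem_space_iff.mp hx
  obtain ⟨τ, hστ, hτ⟩ := hfin.exists_le_maximal hσ
  exact ⟨τ, ⟨hτ.1, fun t ht hle => le_antisymm hle (hτ.2 ht hle)⟩,
    convexHull_mono (Finset.coe_subset.mpr hστ) hxσ⟩

lemma measurableSet_simplex (τ : Finset (Space d)) :
    MeasurableSet (convexHull ℝ (τ : Set (Space d))) :=
  (τ.finite_toSet.isCompact_convexHull ℝ).isClosed.measurableSet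

/-! ### The element forms -/

lemma integrable_inner_H1grad (u v : H1 d) (s : Set (Space d)) :
    Integrable (fun x => ⟪H1grad u x, H1grad v x⟫_ℝ) ((volD d).restrict s) :=
  (L2.integrable_inner (𝕜 := ℝ) (H1grad u) (H1grad v)).integrableOn

/-- The contribution `∫_τ ∇u · ∇v` of an element, as a bilinear form on `H^1_0(D)`. -/
noncomputable def elementForm (τ : Finset (Space d)) : LinearMap.BilinForm ℝ (H10 d) :=
  LinearMap.mk₂ ℝ (fun u v => ∫ x in convexHull ℝ (τ : Set (Space d)),
      ⟪H1grad (u : H1 d) x, H1grad (v : H1 d) x⟫_ℝ ∂(volD d))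
    (fun u u' v => by
      rw [← integral_add (integrable_inner_H1grad _ _ _) (integrable_inner_H1grad _ _ _)]
      refine integral_congr_ae (ae_restrict_of_ae ?_)
      filter_upwards [Lp.coeFn_add (H1grad (u : H1 d)) (H1grad (u' : H1 d))] with x hx
      rw [← inner_add_left]
      exact congrArg (fun y => ⟪y, H1grad (v : H1 d) x⟫_ℝ) hx)
    (fun c u v => by
      rw [smul_eq_mul, ← integral_const_mul]
      refine integral_congr_ae (ae_restrict_of_ae ?_)
      filter_upwards [Lp.coeFn_smul c (H1grad (u : H1 d))] with x hx
      rw [← real_inner_smul_left]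
      exact congrArg (fun y => ⟪y, H1grad (v : H1 d) x⟫_ℝ) hx)
    (fun u v v' => by
      rw [← integral_add (integrable_inner_H1grad _ _ _) (integrable_inner_H1grad _ _ _)]
      refine integral_congr_ae (ae_restrict_of_ae ?_)
      filter_upwards [Lp.coeFn_add (H1grad (v : H1 d)) (H1grad (v' : H1 d))] with x hx
      rw [← inner_add_right]
      exact congrArg (fun y => ⟪H1grad (u : H1 d) x, y⟫_ℝ) hx)
    (fun c u v => by
      rw [smul_eq_mul, ← integral_const_mul]
      refine integral_congr_ae (ae_restrict_of_ae ?_)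
      filter_upwards [Lp.coeFn_smul c (H1grad (v : H1 d))] with x hx
      rw [← real_inner_smul_right]
      exact congrArg (fun y => ⟪H1grad (u : H1 d) x, y⟫_ℝ) hx)

lemma elementForm_apply (τ : Finset (Space d)) (u v : H10 d) :
    elementForm τ u v = ∫ x in convexHull ℝ (τ : Set (Space d)),
      ⟪H1grad (u : H1 d) x, H1grad (v : H1 d) x⟫_ℝ ∂(volD d) := rfl

lemma elementForm_self_nonneg (τ : Finset (Space d)) (u : H10 d) : 0 ≤ elementForm τ u u :=
  integral_nonneg fun _ => real_inner_self_nonneg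

lemma elementForm_symm (τ : Finset (Space d)) (u v : H10 d) :
    elementForm τ u v = elementForm τ v u := by
  simp only [elementForm_apply, real_inner_comm]

/-- The elements cover the domain, so the element forms control the norm of `H^1_0(D)`. That the
elements overlap only in null sets is not needed. -/
lemma norm_sq_le_sum_elementForm (hd : 0 < d) (hK : IsGridTriangulation m K)
    {T : Finset (Finset (Space d))} (hT : ∀ τ ∈ K.facets, τ ∈ T) (v : H10 d) :
    ‖v‖ ^ 2 ≤ √5 ^ 2 * ∑ τ ∈ T, elementForm τ v v := by
  rw [Real.sq_sqrt (by norm_num)]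
  refine (norm_sq_le_norm_H1grad_sq hd v).trans ?_
  gcongr
  have hI := L2.integrable_inner (𝕜 := ℝ) (H1grad (v : H1 d)) (H1grad (v : H1 d))
  have hI' : ∀ τ : Finset (Space d), Integrable ((convexHull ℝ (τ : Set (Space d))).indicator
      fun x => ⟪H1grad (v : H1 d) x, H1grad (v : H1 d) x⟫_ℝ) (volD d) := fun τ =>
    hI.indicator (measurableSet_simplex τ)
  have hsum : ∑ τ ∈ T, elementForm τ v v =
      ∫ x, ∑ τ ∈ T, (convexHull ℝ (τ : Set (Space d))).indicator
        (fun x => ⟪H1grad (v : H1 d) x, H1grad (v : H1 d) x⟫_ℝ) x ∂(volD d) := by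
    rw [integral_finsetSum _ fun τ _ => hI' τ]
    exact Finset.sum_congr rfl fun τ _ => (integral_indicator (measurableSet_simplex τ)).symm
  rw [hsum, ← real_inner_self_eq_norm_sq, L2.inner_def]
  refine integral_mono_ae hI (integrable_finsetSum _ fun τ _ => hI' τ) ?_
  filter_upwards [ae_restrict_mem (isOpen_openCube d).measurableSet] with x hx
  have hxK : x ∈ K.space := by
    rw [hK.space_eq]
    exact fun i => ⟨(hx i).1.le, (hx i).2.le⟩
  obtain ⟨τ, hτ, hxτ⟩ := exists_facet_of_mem_space (finite_faces hK) hxK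
  calc ⟪H1grad (v : H1 d) x, H1grad (v : H1 d) x⟫_ℝ
      = (convexHull ℝ (τ : Set (Space d))).indicator
        (fun x => ⟪H1grad (v : H1 d) x, H1grad (v : H1 d) x⟫_ℝ) x := by
        rw [indicator_of_mem hxτ]
    _ ≤ _ := Finset.single_le_sum (f := fun τ : Finset (Space d) =>
        (convexHull ℝ (τ : Set (Space d))).indicator
        (fun x => ⟪H1grad (v : H1 d) x, H1grad (v : H1 d) x⟫_ℝ) x)
        (fun τ _ => indicator_nonneg (fun _ _ => real_inner_self_nonneg) x) (hT τ hτ)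

/-! ### Finite dimensionality of the finite element space -/

/-- The continuous piecewise linear functions, extended by zero outside the cube so that they are
determined by their values on it. -/
def plFunctions (K : Geometry.SimplicialComplex ℝ (Space d)) : Submodule ℝ (Space d → ℝ) where
  carrier := {w | ContinuousOn w (closedCube d) ∧
    (∀ τ ∈ K.faces, ∃ A : Space d →ᵃ[ℝ] ℝ, EqOn w A (convexHull ℝ (τ : Set (Space d)))) ∧
    ∀ x ∉ closedCube d, w x = 0}
  zero_mem' := ⟨continuousOn_const, fun _ _ => ⟨0, fun _ _ => rfl⟩, fun _ _ => rfl⟩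
  add_mem' := by
    rintro w w' ⟨h1, h2, h3⟩ ⟨h1', h2', h3'⟩
    refine ⟨h1.add h1', fun τ hτ => ?_, fun x hx => by rw [Pi.add_apply, h3 x hx, h3' x hx, add_zero]⟩
    obtain ⟨A, hA⟩ := h2 τ hτ
    obtain ⟨A', hA'⟩ := h2' τ hτ
    exact ⟨A + A', fun x hx => by simp [hA hx, hA' hx]⟩
  smul_mem' := by
    rintro c w ⟨h1, h2, h3⟩
    refine ⟨h1.const_smul c, fun τ hτ => ?_, fun x hx => by rw [Pi.smul_apply, h3 x hx, smul_zero]⟩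
    obtain ⟨A, hA⟩ := h2 τ hτ
    exact ⟨c • A, fun x hx => by simp [hA hx]⟩

/-- A piecewise linear function is determined by its values at the vertices. -/
lemma eq_zero_of_vertices (hK : IsGridTriangulation m K) {w : Space d → ℝ}
    (hw : w ∈ plFunctions K) (h0 : ∀ a : GridIdx m, w (gridPoint m fun i => (a i : ℕ)) = 0) :
    w = 0 := by
  obtain ⟨-, hA, hout⟩ := hw
  funext x
  by_cases hx : x ∈ closedCube d
  · rw [← hK.space_eq] at hx
    obtain ⟨τ, hτ, hxτ⟩ := Geometry.SimplicialComplex.mem_space_iff.mp hx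
    obtain ⟨A, hA⟩ := hA τ hτ
    have hsub : convexHull ℝ (τ : Set (Space d)) ⊆ A ⁻¹' {0} := by
      refine convexHull_min (fun y hy => ?_) ((convex_singleton 0).affine_preimage A)
      have hyv : y ∈ gridPoints m := by
        rw [← hK.vertices_eq, K.vertices_eq]
        exact mem_biUnion hτ hy
      obtain ⟨a, rfl⟩ := hyv
      rw [mem_preimage, ← hA (subset_convexHull ℝ _ hy)]
      exact h0 a
    rw [hA hxτ]
    exact hsub hxτ
  · exact hout x hx

lemma finiteDimensional_plFunctions (hK : IsGridTriangulation m K) :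
    FiniteDimensional ℝ (plFunctions K) := by
  let ev : plFunctions K →ₗ[ℝ] (GridIdx m → ℝ) :=
    (LinearMap.pi fun a => LinearMap.proj (gridPoint m fun i => (a i : ℕ))).comp
      (plFunctions K).subtype
  refine FiniteDimensional.of_injective ev ?_
  rw [← LinearMap.ker_eq_bot, LinearMap.ker_eq_bot']
  exact fun w hw => Subtype.ext (eq_zero_of_vertices hK w.2 fun a => congrFun hw a)

lemma memLp_of_mem_plFunctions {w : Space d → ℝ} (hw : w ∈ plFunctions K) :
    MemLp w 2 (volD d) := by
  have hsub : openCube d ⊆ closedCube d := fun x hx i => ⟨(hx i).1.le, (hx i).2.le⟩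
  obtain ⟨M, hM⟩ := (isCompact_closedCube d).exists_bound_of_continuousOn hw.1
  refine MemLp.of_bound ((hw.1.mono hsub).aestronglyMeasurable
    (isOpen_openCube d).measurableSet) M ?_
  filter_upwards [ae_restrict_mem (isOpen_openCube d).measurableSet] with x hx
  exact hM x (hsub hx)

/-- The class in `L²(D)` of a continuous piecewise linear function. -/
noncomputable def plToLp (K : Geometry.SimplicialComplex ℝ (Space d)) :
    plFunctions K →ₗ[ℝ] Lp ℝ 2 (volD d) where
  toFun w := (memLp_of_mem_plFunctions w.2).toLp
  map_add' w w' := MemLp.toLp_add (memLp_of_mem_plFunctions w.2) (memLp_of_mem_plFunctions w'.2)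
  map_smul' c w := MemLp.toLp_const_smul c (memLp_of_mem_plFunctions w.2)

/-- The finite element space as a subspace of `H^1_0(D)`. -/
def feSubmodule (K : Geometry.SimplicialComplex ℝ (Space d)) : Submodule ℝ (H10 d) where
  carrier := feSpace K
  zero_mem' := ⟨0, continuousOn_const, fun _ _ => ⟨0, fun _ _ => rfl⟩, Lp.coeFn_zero _ _ _⟩
  add_mem' := by
    rintro v v' ⟨w, h1, h2, h3⟩ ⟨w', h1', h2', h3'⟩
    refine ⟨w + w', h1.add h1', fun τ hτ => ?_, ?_⟩
    · obtain ⟨A, hA⟩ := h2 τ hτ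
      obtain ⟨A', hA'⟩ := h2' τ hτ
      exact ⟨A + A', fun x hx => by simp [hA hx, hA' hx]⟩
    · exact (Lp.coeFn_add (H1val (v : H1 d)) (H1val (v' : H1 d))).trans (h3.add h3')
  smul_mem' := by
    rintro c v ⟨w, h1, h2, h3⟩
    refine ⟨c • w, h1.const_smul c, fun τ hτ => ?_, ?_⟩
    · obtain ⟨A, hA⟩ := h2 τ hτ
      exact ⟨c • A, fun x hx => by simp [hA hx]⟩
    · exact (Lp.coeFn_smul c (H1val (v : H1 d))).trans (h3.const_smul c)

/-- The restriction of `u ↦ (u, ∇u) ↦ u` to the finite element space. -/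
noncomputable def feVal (K : Geometry.SimplicialComplex ℝ (Space d)) :
    feSubmodule K →ₗ[ℝ] Lp ℝ 2 (volD d) where
  toFun v := H1val ((v : H10 d) : H1 d)
  map_add' _ _ := rfl
  map_smul' _ _ := rfl

lemma feVal_injective : Function.Injective (feVal K) := by
  intro v v' h
  have h1 : H1val ((v - v' : H10 d) : H1 d) = 0 := sub_eq_zero.mpr h
  have h2 := norm_sq_eq_H1val_H1grad ((v - v' : H10 d) : H1 d)
  rw [h1, H1grad_eq_zero h1] at h2
  have h3 : ‖((v - v' : H10 d) : H1 d)‖ = 0 := by simpa using h2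
  exact Subtype.ext (sub_eq_zero.mp (Subtype.ext (norm_eq_zero.mp h3)))

lemma feVal_mem_range (hK : IsGridTriangulation m K) (v : feSubmodule K) :
    feVal K v ∈ LinearMap.range (plToLp K) := by
  classical
  obtain ⟨w, h1, h2, h3⟩ := v.2
  have hw : (closedCube d).indicator w ∈ plFunctions K := by
    refine ⟨h1.congr fun x hx => indicator_of_mem hx w, fun τ hτ => ?_,
      fun x hx => indicator_of_notMem hx w⟩
    obtain ⟨A, hA⟩ := h2 τ hτ
    refine ⟨A, fun x hx => ?_⟩
    have hxc : x ∈ closedCube d :=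
      hK.space_eq ▸ Geometry.SimplicialComplex.convexHull_subset_space hτ hx
    rw [indicator_of_mem hxc]
    exact hA hx
  refine ⟨⟨_, hw⟩, Lp.ext ?_⟩
  refine (MemLp.coeFn_toLp (memLp_of_mem_plFunctions hw)).trans (Filter.EventuallyEq.trans ?_ h3.symm)
  filter_upwards [ae_restrict_mem (isOpen_openCube d).measurableSet] with x hx
  exact indicator_of_mem (fun i => ⟨(hx i).1.le, (hx i).2.le⟩) w

lemma finiteDimensional_feSubmodule (hK : IsGridTriangulation m K) :
    FiniteDimensional ℝ (feSubmodule K) := by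
  have := finiteDimensional_plFunctions hK
  refine FiniteDimensional.of_injective
    ((feVal K).codRestrict (LinearMap.range (plToLp K)) (feVal_mem_range hK)) fun v v' h => ?_
  exact feVal_injective (congrArg Subtype.val h)

/-! ### Interpolation and quadrature -/

/-- The bound also holds at points outside the cube, where the barycentric coordinates are set to
zero. -/
lemma sum_abs_baryCoord_le (hm : ∀ i, 0 < m i) (x : Space d) :
    ∑ a : GridIdx m, |baryCoord K x (gridPoint m fun i => (a i : ℕ))| ≤ 1 := by
  classical
  unfold baryCoord
  split_ifs with h
  · obtain ⟨τ, -, h1, h2, h3, -⟩ := h.choose_spec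
    set β := h.choose
    have hβ : ∀ v, 0 ≤ β v := fun v => by
      by_cases hv : v ∈ τ
      · exact h1 v hv
      · exact (h2 v hv).ge
    simp only [abs_of_nonneg (hβ _)]
    rw [← Finset.sum_image (f := β) (s := Finset.univ)
      (g := fun a : GridIdx m => gridPoint m fun i => (a i : ℕ))
      fun a _ b _ hab => gridPoint_injective hm hab, ← h3]
    rw [← Finset.sum_filter_add_sum_filter_not _ (· ∈ τ), Finset.sum_eq_zero (s := Finset.filter
      (· ∉ τ) _) fun v hv => h2 v (Finset.mem_filter.mp hv).2, add_zero]
    exact Finset.sum_le_sum_of_subset_of_nonneg (fun v hv => (Finset.mem_filter.mp hv).2)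
      fun v _ _ => hβ v
  · simp

lemma plInterpolant_sub (z z' : GridIdx m → ℝ) (x : Space d) :
    plInterpolant m K z x - plInterpolant m K z' x = plInterpolant m K (z - z') x := by
  unfold plInterpolant
  rw [← Finset.sum_sub_distrib]
  exact Finset.sum_congr rfl fun a _ => by rw [Pi.sub_apply, mul_sub]

lemma abs_plInterpolant_le (hm : ∀ i, 0 < m i) (z : GridIdx m → ℝ) (x : Space d) :
    |plInterpolant m K z x| ≤ ‖z‖ := by
  unfold plInterpolant
  calc _ ≤ ∑ a : GridIdx m, |baryCoord K x (gridPoint m fun i => (a i : ℕ))| * ‖z‖ := by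
        refine (Finset.abs_sum_le_sum_abs _ _).trans (Finset.sum_le_sum fun a _ => ?_)
        rw [abs_mul]
        gcongr
        exact norm_le_pi_norm z a
    _ ≤ 1 * ‖z‖ := by
        rw [← Finset.sum_mul]
        gcongr
        exact sum_abs_baryCoord_le hm x
    _ = ‖z‖ := one_mul _

lemma abs_exp_sub_exp_le {s t M : ℝ} (hs : s ≤ M) (ht : t ≤ M) :
    |Real.exp s - Real.exp t| ≤ Real.exp M * |s - t| := by
  wlog h : t ≤ s generalizing s t
  · rw [abs_sub_comm, abs_sub_comm s]
    exact this ht hs (le_of_not_ge h)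
  rw [abs_of_nonneg (sub_nonneg.mpr (Real.exp_le_exp.mpr h)), abs_of_nonneg (sub_nonneg.mpr h)]
  have h1 : Real.exp t = Real.exp s * Real.exp (t - s) := by rw [← Real.exp_add]; congr 1; ring
  have h2 := Real.add_one_le_exp (t - s)
  have h3 := Real.exp_le_exp.mpr hs
  have h4 := Real.exp_pos s
  rw [h1]
  nlinarith

/-- The quadrature average of the log-normal coefficient on an element. -/
noncomputable def quadAverage (R : QuadratureRule K) (z : GridIdx m → ℝ)
    (τ : Finset (Space d)) : ℝ :=
  ∑ y ∈ R.nodes τ, R.weight τ y * Real.exp (plInterpolant m K z y)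

lemma exp_neg_norm_le_quadAverage (hm : ∀ i, 0 < m i) (R : QuadratureRule K) (z : GridIdx m → ℝ)
    {τ : Finset (Space d)} (hτ : τ ∈ K.facets) : Real.exp (-‖z‖) ≤ quadAverage R z τ := by
  rw [← one_mul (Real.exp (-‖z‖)), ← R.weight_sum τ hτ, Finset.sum_mul]
  refine Finset.sum_le_sum fun y hy => mul_le_mul_of_nonneg_left ?_ (R.weight_nonneg τ hτ y hy)
  exact Real.exp_le_exp.mpr (neg_le_of_abs_le (abs_plInterpolant_le hm z y))

lemma abs_quadAverage_sub_le (hm : ∀ i, 0 < m i) (R : QuadratureRule K) (z z' : GridIdx m → ℝ)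
    {τ : Finset (Space d)} (hτ : τ ∈ K.facets) :
    |quadAverage R z τ - quadAverage R z' τ| ≤ Real.exp (‖z‖ + ‖z'‖) * ‖z - z'‖ := by
  unfold quadAverage
  rw [← Finset.sum_sub_distrib]
  calc _ ≤ ∑ y ∈ R.nodes τ, R.weight τ y * (Real.exp (‖z‖ + ‖z'‖) * ‖z - z'‖) := by
        refine (Finset.abs_sum_le_sum_abs _ _).trans (Finset.sum_le_sum fun y hy => ?_)
        rw [← mul_sub, abs_mul, abs_of_nonneg (R.weight_nonneg τ hτ y hy)]
        refine mul_le_mul_of_nonneg_left ?_ (R.weight_nonneg τ hτ y hy)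
        have h1 := (le_abs_self _).trans (abs_plInterpolant_le (K := K) hm z y)
        have h2 := (le_abs_self _).trans (abs_plInterpolant_le (K := K) hm z' y)
        have h3 := norm_nonneg z
        have h4 := norm_nonneg z'
        refine (abs_exp_sub_exp_le (M := ‖z‖ + ‖z'‖) (by linarith) (by linarith)).trans ?_
        gcongr
        rw [plInterpolant_sub]
        exact abs_plInterpolant_le hm _ y
    _ = Real.exp (‖z‖ + ‖z'‖) * ‖z - z'‖ := by rw [← Finset.sum_mul, R.weight_sum τ hτ, one_mul]

/-! ### Stability of the finite element solution -/

-- the norm inherited from `H^1(D)`, registered directly because instance search does not otherwise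
-- find the normed space structure compatible with the bilinear forms
noncomputable instance (d : ℕ) : NormedAddCommGroup (H10 d) := (H10 d).normedAddCommGroup

noncomputable instance (d : ℕ) : NormedSpace ℝ (H10 d) := (H10 d).normedSpace

lemma feForm_eq_sum (hfin : K.facets.Finite) (R : QuadratureRule K) (z : GridIdx m → ℝ)
    (u v : H10 d) : feForm R (fun x => Real.exp (plInterpolant m K z x)) u v =
      ∑ τ ∈ hfin.toFinset, quadAverage R z τ * elementForm τ u v :=
  finsum_mem_eq_finite_toFinset_sum _ hfin

lemma isFESolution_feSolution (hd : 0 < d) (hm : ∀ i, 0 < m i) (hK : IsGridTriangulation m K)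
    (R : QuadratureRule K) (f : H10 d →L[ℝ] ℝ) (z : GridIdx m → ℝ) :
    IsFESolution R f (fun x => Real.exp (plInterpolant m K z x))
      (feSolution R f fun x => Real.exp (plInterpolant m K z x)) := by
  have hfin : K.facets.Finite := (finite_faces hK).subset K.facets_subset
  have := finiteDimensional_feSubmodule hK
  have hex : ∃ u, IsFESolution R f (fun x => Real.exp (plInterpolant m K z x)) u := by
    obtain ⟨u, hu, hsol⟩ := exists_galerkin_solution (E := H10 d) (T := hfin.toFinset) (κ := √5)
      (c := quadAverage R z) (feSubmodule K) elementForm_self_nonneg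
      (norm_sq_le_sum_elementForm hd hK fun τ hτ => hfin.mem_toFinset.mpr hτ)
      (Real.exp_pos (-‖z‖))
      (fun τ hτ => exp_neg_norm_le_quadAverage hm R z (hfin.mem_toFinset.mp hτ)) f
    exact ⟨u, hu, fun v hv => by rw [feForm_eq_sum hfin]; exact hsol v hv⟩
  rw [feSolution, dif_pos hex]
  exact hex.choose_spec

/-- The pathwise stability estimate: the finite element solution depends on the grid values of the
log-coefficient in a locally Lipschitz way, with constants that do not see the mesh. -/
lemma norm_feSolution_sub_le (hd : 0 < d) (hm : ∀ i, 0 < m i)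
    (hK : IsGridTriangulation m K) (R : QuadratureRule K) (f : H10 d →L[ℝ] ℝ)
    {z z' : GridIdx m → ℝ} {u u' : H10 d}
    (hu : IsFESolution R f (fun x => Real.exp (plInterpolant m K z x)) u)
    (hu' : IsFESolution R f (fun x => Real.exp (plInterpolant m K z' x)) u') :
    ‖u - u'‖ ≤ √5 ^ 2 * ‖f‖ *
      ((Real.exp (-‖z‖))⁻¹ * (Real.exp (-‖z'‖))⁻¹ * (Real.exp (‖z‖ + ‖z'‖) * ‖z - z'‖)) := by
  have hfin : K.facets.Finite := (finite_faces hK).subset K.facets_subset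
  exact norm_galerkin_sub_le (E := H10 d) (T := hfin.toFinset) (κ := √5) (c := quadAverage R z)
    (c' := quadAverage R z') (feSubmodule K) elementForm_self_nonneg elementForm_symm
    (Real.sqrt_nonneg _)
    (norm_sq_le_sum_elementForm hd hK fun τ hτ => hfin.mem_toFinset.mpr hτ)
    (Real.exp_pos (-‖z‖))
    (fun τ hτ => exp_neg_norm_le_quadAverage hm R z (hfin.mem_toFinset.mp hτ))
    (Real.exp_pos (-‖z'‖))
    (fun τ hτ => exp_neg_norm_le_quadAverage hm R z' (hfin.mem_toFinset.mp hτ))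
    (fun τ hτ => abs_quadAverage_sub_le hm R z z' (hfin.mem_toFinset.mp hτ))
    (by positivity) f hu.1 hu'.1
    (fun v hv => (feForm_eq_sum hfin R z u v).symm.trans (hu.2 v hv))
    (fun v hv => (feForm_eq_sum hfin R z' u' v).symm.trans (hu'.2 v hv))

lemma norm_feSolutionOfSample_sub_le (hd : 0 < d) (hm : ∀ i, 0 < m i)
    (hK : IsGridTriangulation m K) (R : QuadratureRule K) (f : H10 d →L[ℝ] ℝ)
    (z z' : GridIdx m → ℝ) :
    ‖feSolutionOfSample m R f z - feSolutionOfSample m R f z'‖ ≤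
      5 * ‖f‖ * (Real.exp (2 * ‖z‖) * Real.exp (2 * ‖z'‖) * ‖z - z'‖) := by
  have h := norm_feSolution_sub_le hd hm hK R f (isFESolution_feSolution hd hm hK R f z)
    (isFESolution_feSolution hd hm hK R f z')
  refine h.trans (le_of_eq ?_)
  rw [Real.sq_sqrt (by norm_num), ← Real.exp_neg, ← Real.exp_neg, neg_neg, neg_neg, two_mul,
    two_mul]
  simp only [Real.exp_add]
  ring

lemma continuous_feSolutionOfSample (hd : 0 < d) (hm : ∀ i, 0 < m i)
    (hK : IsGridTriangulation m K) (R : QuadratureRule K) (f : H10 d →L[ℝ] ℝ) :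
    Continuous (feSolutionOfSample m R f) := by
  refine continuous_iff_continuousAt.mpr fun z => tendsto_iff_norm_sub_tendsto_zero.mpr ?_
  have hlim : Filter.Tendsto (fun y : GridIdx m → ℝ =>
      5 * ‖f‖ * (Real.exp (2 * ‖y‖) * Real.exp (2 * ‖z‖) * ‖y - z‖)) (nhds z) (nhds 0) := by
    have hc : Continuous fun y : GridIdx m → ℝ =>
        5 * ‖f‖ * (Real.exp (2 * ‖y‖) * Real.exp (2 * ‖z‖) * ‖y - z‖) := by fun_prop
    simpa using hc.tendsto z
  exact squeeze_zero (fun _ => norm_nonneg _)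
    (fun y => norm_feSolutionOfSample_sub_le hd hm hK R f y z) hlim

lemma feSolutionOfSample_sub_mem (R : QuadratureRule K) (f : H10 d →L[ℝ] ℝ)
    (z z' : GridIdx m → ℝ) :
    feSolutionOfSample m R f z - feSolutionOfSample m R f z' ∈ H10 d :=
  (H10 d).sub_mem (Subtype.property _) (Subtype.property _)

end FiniteElements

/-! ### The functional and the final estimate -/

/-- The mean value theorem in integral form. -/
lemma avgDeriv_sub_eq {d : ℕ} {G : H1 d → ℝ} (hG : ContDiff ℝ 1 G) (u w : H1 d) :
    avgDeriv G u w (w - u) = G w - G u := by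
  have hdiff := hG.differentiable one_ne_zero
  have hγ : Continuous fun θ : ℝ => u + θ • (w - u) := by fun_prop
  have hder : ∀ θ ∈ Set.uIcc (0 : ℝ) 1, HasDerivAt (fun θ : ℝ => G (u + θ • (w - u)))
      (lineDeriv ℝ G (u + θ • (w - u)) (w - u)) θ := fun θ _ => by
    rw [(hdiff _).lineDeriv_eq_fderiv]
    refine (hdiff _).hasFDerivAt.comp_hasDerivAt θ ?_
    simpa using ((hasDerivAt_id θ).smul_const (w - u)).const_add u
  have hcont : Continuous fun θ : ℝ => lineDeriv ℝ G (u + θ • (w - u)) (w - u) := by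
    simp only [(hdiff _).lineDeriv_eq_fderiv]
    exact ((hG.continuous_fderiv one_ne_zero).comp hγ).clm_apply continuous_const
  rw [avgDeriv, intervalIntegral.integral_eq_sub_of_hasDerivAt hder
    (hcont.intervalIntegrable 0 1)]
  simp

lemma mul_rpow_le_add {a b p : ℝ} (ha : 0 ≤ a) (hb : 0 ≤ b) (hp : 0 ≤ p) :
    (a * b) ^ p ≤ a ^ (2 * p) + b ^ (2 * p) := by
  rw [Real.mul_rpow ha hb, two_mul, Real.rpow_add_of_nonneg ha hp hp,
    Real.rpow_add_of_nonneg hb hp hp]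
  nlinarith [sq_nonneg (a ^ p - b ^ p), Real.rpow_nonneg ha p, Real.rpow_nonneg hb p]

lemma mul_mul_rpow_le_add {a b c : ℝ} (ha : 0 ≤ a) (hb : 0 ≤ b) (hc : 0 ≤ c) (p : ℝ) :
    (a * b * c) ^ p ≤ a ^ (3 * p) + b ^ (3 * p) + c ^ (3 * p) := by
  have h3 : ∀ {x : ℝ}, 0 ≤ x → x ^ (3 * p) = (x ^ p) ^ 3 := fun {x} hx => by
    rw [mul_comm, Real.rpow_mul hx]
    exact_mod_cast Real.rpow_natCast (x ^ p) 3
  rw [Real.mul_rpow (mul_nonneg ha hb) hc, Real.mul_rpow ha hb, h3 ha, h3 hb, h3 hc]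
  have hx := Real.rpow_nonneg ha p
  have hy := Real.rpow_nonneg hb p
  have hz := Real.rpow_nonneg hc p
  set x := a ^ p
  set y := b ^ p
  set z := c ^ p
  -- the product is equal to `2 (x³ + y³ + z³ - 3xyz)`
  have h1 : 0 ≤ (x + y + z) * ((x - y) ^ 2 + (y - z) ^ 2 + (z - x) ^ 2) := by positivity
  have h2 : 0 ≤ x * y * z := by positivity
  nlinarith

lemma rpow_moment_le_of_eLpNorm_le {Ω : Type*} [MeasurableSpace Ω] {P : Measure Ω} {F : Ω → ℝ}
    (hF : AEStronglyMeasurable F P) {q : ℝ} (hq : 0 < q) {b : ℝ≥0}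
    (hb : eLpNorm F (ENNReal.ofReal q) P ≤ b) :
    Integrable (fun ω => |F ω| ^ q) P ∧ ∫ ω, |F ω| ^ q ∂P ≤ (b : ℝ) ^ q := by
  have hq0 : ENNReal.ofReal q ≠ 0 := by simpa using hq
  have hmem : MemLp F (ENNReal.ofReal q) P := ⟨hF, hb.trans_lt ENNReal.coe_lt_top⟩
  have hint := hmem.integrable_norm_rpow hq0 ENNReal.ofReal_ne_top
  rw [hmem.eLpNorm_eq_integral_rpow_norm hq0 ENNReal.ofReal_ne_top] at hb
  simp only [ENNReal.toReal_ofReal hq.le, Real.norm_eq_abs] at hint hb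
  refine ⟨hint, ?_⟩
  have h0 : 0 ≤ ∫ ω, |F ω| ^ q ∂P := integral_nonneg fun _ => Real.rpow_nonneg (abs_nonneg _) _
  rw [ENNReal.ofReal_le_iff_le_toReal ENNReal.coe_ne_top, ENNReal.coe_toReal] at hb
  exact (Real.rpow_inv_le_iff_of_pos h0 b.2 hq).mp hb

/-- The three factors of the pathwise bound are separated by the arithmetic-geometric mean
inequality, so that no independence between them is needed. -/
lemma integral_prod_rpow_le {Ω : Type*} [MeasurableSpace Ω] {P : Measure Ω} {p : ℝ} (hp : 0 ≤ p)
    {X F N N' T : Ω → ℝ} (hX : AEStronglyMeasurable X P) (hT0 : ∀ ω, 0 ≤ T ω) {A : ℝ}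
    (hA : 0 ≤ A)
    (hle : ∀ᵐ ω ∂P, |X ω| ≤ A * (|F ω| * (Real.exp (2 * N ω) * Real.exp (2 * N' ω)) * T ω))
    {bF bN bT : ℝ}
    (hF : Integrable (fun ω => |F ω| ^ (3 * p)) P ∧ ∫ ω, |F ω| ^ (3 * p) ∂P ≤ bF)
    (hN : Integrable (fun ω => Real.exp (12 * p * N ω)) P ∧
      ∫ ω, Real.exp (12 * p * N ω) ∂P ≤ bN)
    (hN' : Integrable (fun ω => Real.exp (12 * p * N' ω)) P ∧
      ∫ ω, Real.exp (12 * p * N' ω) ∂P ≤ bN)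
    (hT : Integrable (fun ω => T ω ^ (3 * p)) P ∧ ∫ ω, T ω ^ (3 * p) ∂P ≤ bT) :
    Integrable (fun ω => |X ω| ^ p) P ∧
      ∫ ω, |X ω| ^ p ∂P ≤ A ^ p * (bF + (bN + bN) + bT) := by
  have hNN : Integrable (fun ω => Real.exp (12 * p * N ω) + Real.exp (12 * p * N' ω)) P :=
    hN.1.add hN'.1
  have hFNN : Integrable (fun ω => |F ω| ^ (3 * p) +
      (Real.exp (12 * p * N ω) + Real.exp (12 * p * N' ω))) P := hF.1.add hNN
  let Y : Ω → ℝ := fun ω => A ^ p * (|F ω| ^ (3 * p) +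
    (Real.exp (12 * p * N ω) + Real.exp (12 * p * N' ω)) + T ω ^ (3 * p))
  have hYint : Integrable Y P := (hFNN.add hT.1).const_mul _
  have hXY : ∀ᵐ ω ∂P, |X ω| ^ p ≤ Y ω := by
    filter_upwards [hle] with ω hω
    have hE : ∀ t : ℝ, Real.exp (2 * t) ^ (2 * (3 * p)) = Real.exp (12 * p * t) := fun t => by
      rw [← Real.exp_mul]
      congr 1
      ring
    refine (Real.rpow_le_rpow (abs_nonneg _) hω hp).trans ?_
    have hT' := hT0 ω
    rw [Real.mul_rpow hA (by positivity)]
    refine mul_le_mul_of_nonneg_left ?_ (Real.rpow_nonneg hA p)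
    refine (mul_mul_rpow_le_add (abs_nonneg _) (by positivity) (hT0 ω) p).trans ?_
    gcongr
    refine (mul_rpow_le_add (Real.exp_nonneg _) (Real.exp_nonneg _) (by positivity)).trans ?_
    rw [hE, hE]
  have hXm : AEStronglyMeasurable (fun ω => |X ω| ^ p) P :=
    (hX.norm.aemeasurable.pow_const p).aestronglyMeasurable
  have hXint : Integrable (fun ω => |X ω| ^ p) P := hYint.mono' hXm (by
    filter_upwards [hXY] with ω hω
    rwa [Real.norm_of_nonneg (Real.rpow_nonneg (abs_nonneg _) _)])
  refine ⟨hXint, (integral_mono_ae hXint hYint hXY).trans ?_⟩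
  rw [integral_const_mul, integral_add hFNN hT.1, integral_add hF.1 hNN,
    integral_add hN.1 hN'.1]
  refine mul_le_mul_of_nonneg_left ?_ (Real.rpow_nonneg hA p)
  linarith [hF.2, hN.2, hN'.2, hT.2]

/-- The pathwise bound for the functional; the sum of the dropped normal variables is divided by
their number, so that its moments do not depend on `k`. -/
lemma abs_functional_sub_le {d : ℕ} {m J : Fin d → ℕ} (hd : 0 < d) (hm : ∀ i, 0 < m i)
    {K : Geometry.SimplicialComplex ℝ (Space d)} (hK : IsGridTriangulation m K)
    (R : QuadratureRule K) (f : H10 d →L[ℝ] ℝ) (lam x : EmbIdx m J → ℝ)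
    (e : Fin (embSize m J) ≃ EmbIdx m J) {k : ℕ} (hk : 0 < k) {u u' : H1 d}
    (hu : u = feSolutionOfSample m R f (embSample J hm lam x))
    (hu' : u' = feSolutionOfSample m R f (embSample J hm (dropLast e k lam) x))
    {G : H1 d → ℝ} (hG : ContDiff ℝ 1 G) {a : ℝ}
    (ha : ∀ v ∈ H10 d, |avgDeriv G u u' v| ≤ a * ‖v‖) :
    |G u - G u'| ≤ (10 * ‖f‖ * ((√(embSize m J : ℝ))⁻¹ *
        (⨆ j : {j : Fin (embSize m J) // embSize m J ≤ (j : ℕ) + k}, √(lam (e j))) * k)) *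
      (|a| * (Real.exp (2 * ‖embSample J hm lam x‖) *
        Real.exp (2 * ‖embSample J hm (dropLast e k lam) x‖)) *
          ((∑ q ∈ dropped e k, |x q|) / k)) := by
  have hk0 : (k : ℝ) ≠ 0 := by positivity
  have hmem : u' - u ∈ H10 d := by
    rw [hu, hu']
    exact feSolutionOfSample_sub_mem R f _ _
  have h1 := ha _ hmem
  rw [avgDeriv_sub_eq hG] at h1
  have h2 : ‖u' - u‖ ≤ 5 * ‖f‖ * (Real.exp (2 * ‖embSample J hm lam x‖) *
      Real.exp (2 * ‖embSample J hm (dropLast e k lam) x‖) *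
        ‖embSample J hm lam x - embSample J hm (dropLast e k lam) x‖) := by
    rw [norm_sub_rev, hu, hu']
    exact norm_feSolutionOfSample_sub_le hd hm hK R f _ _
  have h3 := norm_embSample_sub_dropLast_le hm lam e k x
  have h4 : |G u - G u'| ≤ |a| * ‖u' - u‖ := by
    rw [abs_sub_comm]
    exact h1.trans (mul_le_mul_of_nonneg_right (le_abs_self a) (norm_nonneg _))
  generalize (⨆ j : {j : Fin (embSize m J) // embSize m J ≤ (j : ℕ) + k}, √(lam (e j))) = L at *
  generalize ∑ q ∈ dropped e k, |x q| = S at *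
  generalize ‖embSample J hm lam x - embSample J hm (dropLast e k lam) x‖ = δ at *
  generalize (√(embSize m J : ℝ))⁻¹ = r at *
  calc |G u - G u'| ≤ |a| * (5 * ‖f‖ * (Real.exp (2 * ‖embSample J hm lam x‖) *
        Real.exp (2 * ‖embSample J hm (dropLast e k lam) x‖) * (2 * r * L * S))) := by
        refine h4.trans (mul_le_mul_of_nonneg_left (h2.trans ?_) (abs_nonneg a))
        gcongr
    _ = _ := by
        field_simp
        ring

end CES

set_option maxHeartbeats 1000000 in
theorem mainTheorem3 {d : ℕ} (hd : 0 < d)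
    -- covariance function: continuous, and symmetric in every coordinate, on `[-1,1]^d`
    (C : CES.Space d → ℝ) (hC : ContinuousOn C (CES.diffCube d))
    (hCsymm : ∀ x ∈ CES.diffCube d, C (WithLp.toLp 2 fun i => |x i|) = C x)
    -- the Gaussian field
    {Ω₀ : Type*} [MeasurableSpace Ω₀] (P₀ : Measure Ω₀) (Z : CES.closedCube d → Ω₀ → ℝ)
    (hZ : CES.IsStationaryGaussianField C Z P₀)
    -- source term, exponent, and bounds for the moments of `C_F`
    (f : CES.H10 d →L[ℝ] ℝ) (p : ℝ) (hp : 1 ≤ p) (B : ℝ → ℝ≥0) :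
    ∃ c : ℝ, 0 < c ∧
      -- grid, padding, cutoff function
      ∀ (m J : Fin d → ℕ) (hm : ∀ i, 0 < m i) (φ : ℝ → ℝ) (κ : ℝ),
        CES.IsSmoothCutoff φ κ → (CES.embMatrix C φ m J).PosDef →
      -- non-increasing ordering of the eigenvalues, truncation index
      ∀ (e : Fin (CES.embSize m J) ≃ CES.EmbIdx m J),
        Antitone (fun j => CES.embEigenvalue C φ m J (e j)) →
      ∀ k : ℕ, k ≤ CES.embSize m J →
      -- finite element mesh and quadrature rule
      ∀ (K : Geometry.SimplicialComplex ℝ (CES.Space d)), CES.IsGridTriangulation m K →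
      ∀ (R : CES.QuadratureRule K),
      -- independent standard normal variables
      ∀ {Ω : Type*} [MeasurableSpace Ω] (P : Measure Ω) [IsProbabilityMeasure P]
        (ξ : CES.EmbIdx m J → Ω → ℝ),
        (∀ q, HasLaw (ξ q) (gaussianReal 0 1) P) → iIndepFun ξ P →
      -- the finite element solutions of the original and of the smoothed sample
      ∀ (u u' : Ω → CES.H1 d),
        (u = fun ω => CES.feSolutionOfSample m R f
          (CES.embSample J hm (CES.embEigenvalue C φ m J) fun q => ξ q ω)) →
        (u' = fun ω => CES.feSolutionOfSample m R f
          (CES.embSample J hm (CES.dropLast e k (CES.embEigenvalue C φ m J)) fun q => ξ q ω)) →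
      -- the functional
      ∀ (G : CES.H1 d → ℝ), ContDiff ℝ 1 G →
      ∀ (CF : Ω → ℝ), AEStronglyMeasurable CF P →
        (∀ q : ℝ, 1 ≤ q → eLpNorm CF (ENNReal.ofReal q) P ≤ B q) →
        (∀ᵐ ω ∂P, ∀ v ∈ CES.H10 d, |CES.avgDeriv G (u ω) (u' ω) v| ≤ CF ω * ‖v‖) →
      Integrable (fun ω => |G (u ω) - G (u' ω)| ^ p) P ∧
      ∫ ω, |G (u ω) - G (u' ω)| ^ p ∂P ≤
        c * (CES.embSize m J : ℝ) ^ (-p / 2) *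
          (⨆ j : {j : Fin (CES.embSize m J) // CES.embSize m J ≤ (j : ℕ) + k},
            √(CES.embEigenvalue C φ m J (e j))) ^ p *
          (k : ℝ) ^ p := by
  -- the arithmetic-geometric mean inequality raises the factors `exp (2‖z‖)` to the power `6p`
  obtain ⟨M, hM0, hM⟩ := CES.exists_embSample_moment_bound hCsymm hZ
    (show (0 : ℝ) ≤ 12 * p by linarith)
  have hp0 : 0 ≤ p := by linarith
  set γ : ℝ := ∫ x, |x| ^ (3 * p) ∂(gaussianReal 0 1)
  have hγ : 0 ≤ γ := integral_nonneg fun _ => Real.rpow_nonneg (abs_nonneg _) _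
  set c₀ : ℝ := (B (3 * p) : ℝ) ^ (3 * p) + (M + M) + γ
  have hc₀ : 0 ≤ c₀ := by positivity
  -- the summand `1` makes the constant positive also for `f = 0`
  refine ⟨(10 * ‖f‖) ^ p * c₀ + 1, by positivity, ?_⟩
  intro m J hm φ κ _ hS e _ k _ K hK R Ω _ P _ ξ hξ hind u u' hu hu' G hG CF hCFm hCFB hCF
  set lam := CES.embEigenvalue C φ m J
  set L := ⨆ j : {j : Fin (CES.embSize m J) // CES.embSize m J ≤ (j : ℕ) + k}, √(lam (e j))
  have hL0 : 0 ≤ L := Real.iSup_nonneg fun j => Real.sqrt_nonneg _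
  set z : Ω → CES.GridIdx m → ℝ := fun ω => CES.embSample J hm lam fun q => ξ q ω with hz
  set z' : Ω → CES.GridIdx m → ℝ :=
    fun ω => CES.embSample J hm (CES.dropLast e k lam) fun q => ξ q ω with hz'
  have hzz : ∀ ω, ‖z ω - z' ω‖ ≤ 2 * (√(CES.embSize m J : ℝ))⁻¹ * L *
      ∑ q ∈ CES.dropped e k, |ξ q ω| := fun ω =>
    CES.norm_embSample_sub_dropLast_le hm lam e k fun q => ξ q ω
  have hs0 : (0 : ℝ) ≤ CES.embSize m J := Nat.cast_nonneg _
  rcases Nat.eq_zero_or_pos k with rfl | hk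
  · -- nothing is dropped and the two solutions coincide
    have huu : ∀ ω, u ω = u' ω := fun ω => by
      have h : z ω = z' ω := by
        refine sub_eq_zero.mp (norm_le_zero_iff.mp ((hzz ω).trans (le_of_eq ?_)))
        have h0 : CES.dropped e 0 = ∅ :=
          Finset.card_eq_zero.mp (Nat.le_zero.mp (CES.card_dropped_le e 0))
        rw [h0, Finset.sum_empty, mul_zero]
      rw [hu, hu']
      exact congrArg (CES.feSolutionOfSample m R f) h
    have h0 : ∀ ω, |G (u ω) - G (u' ω)| ^ p = 0 := fun ω => by
      rw [huu, sub_self, abs_zero, Real.zero_rpow (by linarith)]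
    simp only [h0]
    exact ⟨integrable_zero _ _ _, by rw [integral_zero]; positivity⟩
  have hk0 : (0 : ℝ) < k := mod_cast hk
  have hsol := CES.continuous_feSolutionOfSample hd hm hK R f
  have hmeas : ∀ lam' : CES.EmbIdx m J → ℝ, AEStronglyMeasurable (fun ω =>
      G (CES.feSolutionOfSample m R f (CES.embSample J hm lam' fun q => ξ q ω))) P :=
    fun lam' => (hG.continuous.comp hsol).comp_aestronglyMeasurable
      (CES.embSample_aemeasurable hm lam' hξ).aestronglyMeasurable
  have hXm : AEStronglyMeasurable (fun ω => G (u ω) - G (u' ω)) P := by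
    rw [hu, hu']
    exact (hmeas _).sub (hmeas _)
  have hle : ∀ᵐ ω ∂P, |G (u ω) - G (u' ω)| ≤
      (10 * ‖f‖ * ((√(CES.embSize m J : ℝ))⁻¹ * L * k)) *
        (|CF ω| * (Real.exp (2 * ‖z ω‖) * Real.exp (2 * ‖z' ω‖)) *
          ((∑ q ∈ CES.dropped e k, |ξ q ω|) / k)) := by
    filter_upwards [hCF] with ω hω
    exact CES.abs_functional_sub_le hd hm hK R f lam (fun q => ξ q ω) e hk (congrFun hu ω)
      (congrFun hu' ω) hG hω
  have hmoment := hM m J hm φ hS.posSemidef e k P ξ hξ hind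
  have hfinal := CES.integral_prod_rpow_le hp0 hXm
    (fun ω => div_nonneg (Finset.sum_nonneg fun q _ => abs_nonneg _) hk0.le)
    (by positivity) hle
    (CES.rpow_moment_le_of_eLpNorm_le hCFm (by linarith) (hCFB (3 * p) (by linarith)))
    hmoment.1 hmoment.2 (CES.moment_sum_dropped_le e hξ (by linarith) hk)
  refine ⟨hfinal.1, hfinal.2.trans ?_⟩
  have hroot : ((√(CES.embSize m J : ℝ))⁻¹) ^ p = (CES.embSize m J : ℝ) ^ (-p / 2) := by
    rw [Real.sqrt_eq_rpow, ← Real.rpow_neg hs0, ← Real.rpow_mul hs0]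
    congr 1
    ring
  rw [Real.mul_rpow (by positivity) (by positivity), Real.mul_rpow (by positivity) hk0.le,
    Real.mul_rpow (by positivity) hL0, hroot]
  have hrest : 0 ≤ (CES.embSize m J : ℝ) ^ (-p / 2) * L ^ p * (k : ℝ) ^ p := by positivity
  calc _ = ((10 * ‖f‖) ^ p * c₀) * ((CES.embSize m J : ℝ) ^ (-p / 2) * L ^ p * (k : ℝ) ^ p) := by
        ring
    _ ≤ ((10 * ‖f‖) ^ p * c₀ + 1) * ((CES.embSize m J : ℝ) ^ (-p / 2) * L ^ p * (k : ℝ) ^ p) := by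
        gcongr
        linarith
    _ = _ := by ring
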